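/- **Definitions.** An inverse sequence is an inverse system $X=(X_n,p_{nm})_{n\le m}$ of sets indexed by $\mathbb N$, with bonding maps $p_{nm}:X_m\to X_n$. A morphism of sequences $(f_n,\Phi):(X_n,p)\to(Y_n,q)$ is a function $\Phi:\mathbb N\to\mathbb N$ with maps $f_n:X_{\Phi(n)}\to Y_n$ such that for all $n<n'$ there is $m\ge\Phi(n),\Phi(n')$ with $f_n p_{\Phi(n)m}=q_{nn'}f_{n'}p_{\Phi(n')m}$; and $(f_n,\Phi)\sim(g_n,\Psi)$ if for every $n$ there is $m\ge\Phi(n),\Psi(n)$ with $f_np_{\Phi(n)m}=g_np_{\Psi(n)m}$. $\mathbf{Tower\text{-}Set}$ is the category of inverse sequences and $\sim$-classes of morphisms, and $\mathbf{Tower\text{-}Set}_{ML}$ is its full subcategory of Mittag-Leffler sequences: for every $n_0$ there is $n_1>n_0$ with $p_{n_0n}(X_n)=p_{n_0n_1}(X_{n_1})$ for all $n>n_1$. $\mathcal U$ is the category of complete ultrametric spaces of diameter $\le1$ and uniformly continuous maps. $\mathcal T_{ML}$ is the category whose objects are the rooted simplicial trees (geometric realizations, with edges of length $1$, of graph-theoretic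 trees, with a vertex $v$ as root) that are Mittag-Leffler, i.e. for every $n_0$ there is $n_1>n_0$ such that for all $n>n_1$ the vertices of height $n_0$ lying below some vertex of height $n$ are those lying below some vertex of height $n_1$. Its morphisms are the rooted metrically proper homotopy classes of rooted continuous metrically proper maps (preimages of bounded sets are bounded); a homotopy $H:T\times I\to T'$ with $H(v,t)=w$ for all $t$ is metrically proper if for all $M>0$ there is $N>0$ with $H^{-1}(B(w,M))\subset B(v,N)\times I$. For a category $C$ fix for any two isomorphic objects $X,X'$ an identifying isomorphism $\sigma_{X,X'}:X\to X'$ such that $\sigma_{X,X}=\mathrm{id}$ and $\sigma_{X',X''}\sigma_{X,X'}=\sigma_{X,X''}$ (such systems exist). $C^*$ is the category whose objects are the isomorphism classes of $C$ and whose morphisms are the classes of morphisms of $C$, where $f:X\to Y$ and $f':X'\to Y'$ are equivalent if $jf=f'i$ with $i=\sigma_{X,X'}$, $j=\sigma_{Y,Y'}$; composition is induced by that of $C$. Further, write $[f]$ for the class of $f$ under the coarser relation in which $i:X\to X'$ and $j:Y\to Y'$ may be any isomorphisms, and call $c$ a composite of the classes $a,b$ if $a=[f]$, $b=[g]$, $c=[gf]$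 for some composable $f,g$. Say that a functor $F:C\to D$ *induces an equivalence on classes* if * for every choice of identifying isomorphisms in $C$ and in $D$ there is an equivalence of categories $C^*\simeq D^*$ that maps the isomorphism class of $X$ to that of $F(X)$ and maps the class of a morphism $f$ in $C^*$ to a morphism of $D^*$ all of whose representatives lie in $[F(f)]$; and * $F$ induces a bijection between the isomorphism classes of objects of $C$ and of $D$ and a bijection $[f]\mapsto[F(f)]$ between the classes of morphisms, and $c$ is a composite of $a,b$ if and only if the image of $c$ is a composite of the images of $a,b$. **Theorem.** 1. There is an equivalence of categories $E:\mathbf{Tower\text{-}Set}_{ML}\to\mathcal U$ that induces an equivalence on classes. In particular $\mathbf{Tower\text{-}Set}^*_{ML}$ (isomorphism classes of Mittag-Leffler inverse sequences, with classes of morphisms) and $\mathcal U^*$ (uniform homeomorphism classes of complete ultrametric spaces of diameter $\le1$, with classes of uniformly continuous maps) are equivalent. Consequently, shape morphisms between Mittag-Leffler sequences are represented by uniformly continuous maps between bounded ultrametric spaces: for all Mittag-Leffler $X,Y$ (and every choice of identifying isomorphisms) the morphisms from the class of $X$ to the class of $Y$ in $\mathbf{Tower\text{-}Set}^*_{ML}$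 correspond bijectively to the uniformly continuous maps $E(X)\to E(Y)$, the class of $f:X\to Y$ corresponding to $E(f)$. 2. There is an equivalence of categories $\mathcal U\to\mathcal T_{ML}$ that induces an equivalence on classes. In particular $\mathcal U^*$ and $\mathcal S^*=\mathcal T_{ML}^*$ (metrically proper homotopy classes of Mittag-Leffler rooted simplicial trees, with classes of morphisms) are equivalent. -/

import Mathlib

open CategoryTheory

universe u v u' v'

/-! ## Inverse sequences of sets and the category Tower-Set -/

/-- An inverse sequence of sets: an inverse system indexed by the natural numbers, with bonding
maps `bond : X m → X n` for `n ≤ m`. -/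
structure InvSeq where
  X : ℕ → Type u
  bond : ∀ ⦃n m : ℕ⦄, n ≤ m → X m → X n
  system : InverseSystem bond

namespace InvSeq

lemma bond_bond (A : InvSeq.{u}) {n m k : ℕ} (h : n ≤ m) (h' : m ≤ k) (x : A.X k) :
    A.bond h (A.bond h' x) = A.bond (h.trans h') x :=
  A.system.map_map h h' x

lemma bond_self (A : InvSeq.{u}) {n : ℕ} (h : n ≤ n) (x : A.X n) : A.bond h x = x :=
  A.system.map_self x

/-- The Mittag-Leffler property: the images of the bonding maps in every level stabilize. -/
def IsML (A : InvSeq.{u}) : Prop :=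
  ∀ n₀ : ℕ, ∃ (n₁ : ℕ) (h₁ : n₀ < n₁), ∀ (n : ℕ) (h : n₁ < n),
    Set.range (A.bond (h₁.trans h).le) = Set.range (A.bond h₁.le)

/-- A morphism of inverse sequences: a function `Φ : ℕ → ℕ` and maps `f n : A (Φ n) → B n` which
are compatible with the bonding maps after passing to a sufficiently high level. -/
structure PreHom (A B : InvSeq.{u}) where
  Φ : ℕ → ℕ
  f : ∀ n, A.X (Φ n) → B.X n
  comm : ∀ ⦃n n' : ℕ⦄ (hn : n < n'), ∃ (m : ℕ) (h : Φ n ≤ m) (h' : Φ n' ≤ m),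
    ∀ x : A.X m, f n (A.bond h x) = B.bond hn.le (f n' (A.bond h' x))

namespace PreHom

variable {A B C : InvSeq.{u}}

/-- Two morphisms of sequences are equivalent if each pair of components agrees after restriction
to a sufficiently high level. -/
def Rel (f g : PreHom A B) : Prop :=
  ∀ n, ∃ (m : ℕ) (h : f.Φ n ≤ m) (h' : g.Φ n ≤ m),
    ∀ x : A.X m, f.f n (A.bond h x) = g.f n (A.bond h' x)

lemma comm_le (f : PreHom A B) {n n' : ℕ} (hn : n ≤ n') :
    ∃ (m : ℕ) (h : f.Φ n ≤ m) (h' : f.Φ n' ≤ m),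
      ∀ x : A.X m, f.f n (A.bond h x) = B.bond hn (f.f n' (A.bond h' x)) := by
  rcases hn.lt_or_eq with h | rfl
  · exact f.comm h
  · exact ⟨f.Φ n, le_rfl, le_rfl, fun x => (B.bond_self _ _).symm⟩

lemma rel_equivalence : Equivalence (Rel (A := A) (B := B)) where
  refl f n := ⟨f.Φ n, le_rfl, le_rfl, fun _ => rfl⟩
  symm h n := by
    obtain ⟨m, h₁, h₂, h₃⟩ := h n
    exact ⟨m, h₂, h₁, fun x => (h₃ x).symm⟩
  trans {f g k} h h' n := by
    obtain ⟨m, h₁, h₂, h₃⟩ := h n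
    obtain ⟨m', h₁', h₂', h₃'⟩ := h' n
    refine ⟨max m m', h₁.trans (le_max_left _ _), h₂'.trans (le_max_right _ _), fun x => ?_⟩
    have e₁ := h₃ (A.bond (le_max_left m m') x)
    have e₂ := h₃' (A.bond (le_max_right m m') x)
    simp only [bond_bond] at e₁ e₂
    exact e₁.trans e₂

instance setoid (A B : InvSeq.{u}) : Setoid (PreHom A B) := ⟨Rel, rel_equivalence⟩

/-- The identity morphism of sequences. -/
def id (A : InvSeq.{u}) : PreHom A A where
  Φ n := n
  f _ x := x
  comm n n' hn := ⟨n', hn.le, le_rfl, fun x => by simp only [bond_bond]⟩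

/-- The composite `g ∘ f`, with index function `Φ_f ∘ Φ_g` and components `g n ∘ f (Φ_g n)`. -/
def comp (f : PreHom A B) (g : PreHom B C) : PreHom A C where
  Φ n := f.Φ (g.Φ n)
  f n x := g.f n (f.f (g.Φ n) x)
  comm n n' hn := by
    obtain ⟨m, h, h', e⟩ := g.comm hn
    obtain ⟨k, a, b, c⟩ := f.comm_le h
    obtain ⟨k', a', b', c'⟩ := f.comm_le h'
    refine ⟨max k k', a.trans (le_max_left _ _), a'.trans (le_max_right _ _), fun x => ?_⟩
    have e₁ := c (A.bond (le_max_left k k') x)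
    have e₂ := c' (A.bond (le_max_right k k') x)
    simp only [bond_bond] at e₁ e₂
    rw [e₁, e₂, e]

lemma comp_rel {f f' : PreHom A B} {g g' : PreHom B C} (hf : Rel f f') (hg : Rel g g') :
    Rel (f.comp g) (f'.comp g') := by
  intro n
  obtain ⟨m, h, h', e⟩ := hg n
  obtain ⟨k, a, b, c⟩ := f.comm_le h
  obtain ⟨k', a', b', c'⟩ := f'.comm_le h'
  obtain ⟨l, p, q, r⟩ := hf m
  have i₁ : k ≤ max (max k k') l := (le_max_left _ _).trans (le_max_left _ _)
  have i₂ : k' ≤ max (max k k') l := (le_max_right _ _).trans (le_max_left _ _)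
  have i₃ : l ≤ max (max k k') l := le_max_right _ _
  refine ⟨max (max k k') l, a.trans i₁, a'.trans i₂, fun x => ?_⟩
  have e₁ := c (A.bond i₁ x)
  have e₂ := c' (A.bond i₂ x)
  have e₃ := r (A.bond i₃ x)
  simp only [bond_bond] at e₁ e₂ e₃
  exact (congrArg (g.f n) e₁).trans ((e _).trans
    (congrArg (g'.f n) ((congrArg (B.bond h') e₃).trans e₂.symm)))

end PreHom

/-- The category Tower-Set: inverse sequences of sets and equivalence classes of morphisms of
sequences. -/
instance : Category.{u} InvSeq.{u} where
  Hom A B := Quotient (PreHom.setoid A B)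
  id A := Quotient.mk _ (PreHom.id A)
  comp f g := Quotient.map₂ PreHom.comp (fun _ _ hf _ _ hg => PreHom.comp_rel hf hg) f g
  id_comp f := by
    induction f using Quotient.ind
    rfl
  comp_id f := by
    induction f using Quotient.ind
    rfl
  assoc f g h := by
    induction f using Quotient.ind
    induction g using Quotient.ind
    induction h using Quotient.ind
    rfl

end InvSeq

/-- The full subcategory of Tower-Set on the Mittag-Leffler inverse sequences. -/
abbrev TowerML : Type (u + 1) :=
  ObjectProperty.FullSubcategory (fun A : InvSeq.{u} => A.IsML)

/-! ## Complete ultrametric spaces of diameter at most one -/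

/-- A complete ultrametric space of diameter at most one (possibly empty). -/
structure UltraSpace where
  carrier : Type u
  [metric : MetricSpace carrier]
  [ultra : IsUltrametricDist carrier]
  [complete : CompleteSpace carrier]
  dist_le_one : ∀ x y : carrier, dist x y ≤ 1

attribute [instance] UltraSpace.metric UltraSpace.ultra UltraSpace.complete

/-- Morphisms are the uniformly continuous maps. -/
instance : Category.{u} UltraSpace.{u} where
  Hom X Y := {f : X.carrier → Y.carrier // UniformContinuous f}
  id X := ⟨_root_.id, uniformContinuous_id⟩
  comp f g := ⟨g.1 ∘ f.1, g.2.comp f.2⟩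

/-! ## Rooted simplicial trees and metrically proper homotopy classes -/

/-- The metric space `T` is the geometric realization of the graph `G`, with edges of length one
and with the path metric: `ι` is the inclusion of the vertices, `e a b : [0, 1] → T` is the edge
from `a` to `b`, and a shortest path between points of two distinct edges leaves the first
edge and enters the second one through end points. -/
structure IsUnitRealization {V T : Type u} [MetricSpace T] (G : SimpleGraph V) (ι : V → T)
    (e : V → V → ℝ → T) : Prop where
  dist_vertex : ∀ a b, dist (ι a) (ι b) = G.dist a b
  edge_zero : ∀ a b, G.Adj a b → e a b 0 = ι a
  edge_symm : ∀ a b, G.Adj a b → ∀ t ∈ Set.Icc (0 : ℝ) 1, e b a t = e a b (1 - t)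
  dist_edge : ∀ a b, G.Adj a b → ∀ s ∈ Set.Icc (0 : ℝ) 1, ∀ t ∈ Set.Icc (0 : ℝ) 1,
    dist (e a b s) (e a b t) = |s - t|
  dist_edges : ∀ a b c d, G.Adj a b → G.Adj c d → s(a, b) ≠ s(c, d) →
    ∀ s ∈ Set.Icc (0 : ℝ) 1, ∀ t ∈ Set.Icc (0 : ℝ) 1,
      dist (e a b s) (e c d t) =
        min (min (s + G.dist a c + t) (s + G.dist a d + (1 - t)))
          (min ((1 - s) + G.dist b c + t) ((1 - s) + G.dist b d + (1 - t)))
  cover : ∀ x : T, (∃ a, x = ι a) ∨ ∃ a b, G.Adj a b ∧ ∃ t ∈ Set.Icc (0 : ℝ) 1, x = e a b t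

/-- A rooted simplicial tree: the geometric realization, with edges of length one, of a graph that
is a tree, with a vertex as root. -/
structure SimplicialTree where
  carrier : Type u
  [metric : MetricSpace carrier]
  root : carrier
  simplicial : ∃ (V : Type u) (G : SimpleGraph V) (ι : V → carrier) (e : V → V → ℝ → carrier),
    G.IsTree ∧ IsUnitRealization G ι e ∧ root ∈ Set.range ι

attribute [instance] SimplicialTree.metric

namespace SimplicialTree

/-- The points at distance `n` from the root whose path to the root extends to a path of
length `m` issuing from the root. For integers these points are the vertices of height `n`, and
this is the image of the vertices of height `m` in the vertices of height `n`. -/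
def extendable (T : SimplicialTree.{u}) (n m : ℕ) : Set T.carrier :=
  {α | dist T.root α = n ∧ ∃ β, dist T.root β = m ∧ dist T.root α + dist α β = dist T.root β}

/-- A rooted simplicial tree is Mittag-Leffler if its inverse sequence, consisting of the vertices
of height `n` with the maps to the adjacent vertex nearer to the root, is. -/
def IsML (T : SimplicialTree.{u}) : Prop :=
  ∀ n₀ : ℕ, ∃ n₁ : ℕ, n₀ < n₁ ∧ ∀ n : ℕ, n₁ < n → T.extendable n₀ n = T.extendable n₀ n₁

/-- Rooted continuous metrically proper maps. -/
structure PMap (S T : SimplicialTree.{u}) where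
  map : C(S.carrier, T.carrier)
  map_root : map S.root = T.root
  proper : ∀ A : Set T.carrier, Bornology.IsBounded A → Bornology.IsBounded (map ⁻¹' A)

namespace PMap

variable {R S T : SimplicialTree.{u}}

/-- Rooted metrically proper homotopy. -/
def Homotopic (f g : PMap S T) : Prop :=
  ∃ H : ContinuousMap.Homotopy f.map g.map, (∀ t, H (t, S.root) = T.root) ∧
    ∀ M > (0 : ℝ), ∃ N > (0 : ℝ), ∀ t x, H (t, x) ∈ Metric.ball T.root M →
      x ∈ Metric.ball S.root N

lemma homotopic_equivalence : Equivalence (Homotopic (S := S) (T := T)) where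
  refl f := by
    refine ⟨ContinuousMap.Homotopy.refl _, fun _ => f.map_root, fun M _ => ?_⟩
    obtain ⟨N, hN⟩ := (f.proper _ Metric.isBounded_ball).subset_ball (c := S.root) (s := _)
    exact ⟨max N 1, by positivity, fun t x hx =>
      Metric.ball_subset_ball (le_max_left _ _) (hN hx)⟩
  symm := by
    rintro f g ⟨H, h₁, h₂⟩
    refine ⟨H.symm, fun t => h₁ _, fun M hM => ?_⟩
    obtain ⟨N, hN, h⟩ := h₂ M hM
    exact ⟨N, hN, fun t x hx => h _ x hx⟩
  trans := by
    rintro f g k ⟨H, h₁, h₂⟩ ⟨K, k₁, k₂⟩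
    refine ⟨H.trans K, fun t => ?_, fun M hM => ?_⟩
    · rw [ContinuousMap.Homotopy.trans_apply]
      split_ifs
      · exact h₁ _
      · exact k₁ _
    · obtain ⟨N, hN, h⟩ := h₂ M hM
      obtain ⟨N', hN', h'⟩ := k₂ M hM
      refine ⟨max N N', lt_max_of_lt_left hN, fun t x hx => ?_⟩
      rw [ContinuousMap.Homotopy.trans_apply] at hx
      split_ifs at hx
      · exact Metric.ball_subset_ball (le_max_left _ _) (h _ x hx)
      · exact Metric.ball_subset_ball (le_max_right _ _) (h' _ x hx)

instance setoid (S T : SimplicialTree.{u}) : Setoid (PMap S T) :=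
  ⟨Homotopic, homotopic_equivalence⟩

/-- The identity map. -/
def id (S : SimplicialTree.{u}) : PMap S S where
  map := ContinuousMap.id _
  map_root := rfl
  proper _ h := h

/-- The composite map. -/
def comp (f : PMap R S) (g : PMap S T) : PMap R T where
  map := g.map.comp f.map
  map_root := by
    rw [ContinuousMap.comp_apply, f.map_root, g.map_root]
  proper A h := f.proper _ (g.proper A h)

lemma comp_homotopic {f f' : PMap R S} {g g' : PMap S T} (hf : Homotopic f f')
    (hg : Homotopic g g') : Homotopic (f.comp g) (f'.comp g') := by
  obtain ⟨H, h₁, h₂⟩ := hf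
  obtain ⟨K, k₁, k₂⟩ := hg
  refine ⟨K.comp H, fun t => ?_, fun M hM => ?_⟩
  · change K (t, H (t, R.root)) = T.root
    rw [h₁, k₁]
  · obtain ⟨N, hN, h⟩ := k₂ M hM
    obtain ⟨N', hN', h'⟩ := h₂ N hN
    exact ⟨N', hN', fun t x hx => h' t x (h t _ hx)⟩

end PMap

/-- The category of rooted simplicial trees and rooted metrically proper homotopy classes of rooted
continuous metrically proper maps. -/
instance : Category.{u} SimplicialTree.{u} where
  Hom S T := Quotient (PMap.setoid S T)
  id S := Quotient.mk _ (PMap.id S)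
  comp f g := Quotient.map₂ PMap.comp (fun _ _ hf _ _ hg => PMap.comp_homotopic hf hg) f g
  id_comp f := by
    induction f using Quotient.ind
    rfl
  comp_id f := by
    induction f using Quotient.ind
    rfl
  assoc f g h := by
    induction f using Quotient.ind
    induction g using Quotient.ind
    induction h using Quotient.ind
    rfl

end SimplicialTree

/-- The full subcategory of the Mittag-Leffler rooted simplicial trees. -/
abbrev TreeML : Type (u + 1) :=
  ObjectProperty.FullSubcategory (fun T : SimplicialTree.{u} => T.IsML)

/-! ## Passing to isomorphism classes -/

section Classes

variable (C : Type u) [Category.{v} C]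

/-- Isomorphism classes of objects. -/
abbrev ObjClass : Type u := Quotient (isIsomorphicSetoid C)

/-- Two morphisms `f : X ⟶ Y` and `f' : X' ⟶ Y'` are related if there are isomorphisms
`i : X ≅ X'` and `j : Y ≅ Y'` with `j ∘ f = f' ∘ i`. -/
instance arrowSetoid : Setoid (Arrow C) where
  r f f' := ∃ (i : f.left ≅ f'.left) (j : f.right ≅ f'.right), f.hom ≫ j.hom = i.hom ≫ f'.hom
  iseqv :=
    { refl := fun f => ⟨Iso.refl _, Iso.refl _,
        (Category.comp_id f.hom).trans (Category.id_comp f.hom).symm⟩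
      symm := by
        rintro f g ⟨i, j, h⟩
        exact ⟨i.symm, j.symm, (Iso.eq_inv_comp i).2 (by
          rw [← Category.assoc, ← h, Category.assoc, Iso.symm_hom, j.hom_inv_id, Category.comp_id])⟩
      trans := by
        rintro f g k ⟨i, j, h⟩ ⟨i', j', h'⟩
        exact ⟨i ≪≫ i', j ≪≫ j', by
          rw [Iso.trans_hom, Iso.trans_hom, ← Category.assoc, h, Category.assoc, h', Category.assoc]⟩ }

/-- Classes of morphisms. -/
abbrev ArrowClass : Type (max u v) := Quotient (arrowSetoid C)

variable {C}

/-- The class of a morphism. -/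
def arrowClass {X Y : C} (f : X ⟶ Y) : ArrowClass C := Quotient.mk _ (Arrow.mk f)

/-- `c` is a class of composites of composable representatives of `a` and `b` (first `a`,
then `b`). In general this does not determine `c`. -/
def IsClassComp (a b c : ArrowClass C) : Prop :=
  ∃ (X Y Z : C) (f : X ⟶ Y) (g : Y ⟶ Z),
    a = arrowClass f ∧ b = arrowClass g ∧ c = arrowClass (f ≫ g)

variable {D : Type u'} [Category.{v'} D]

/-- The map of isomorphism classes of objects induced by a functor. -/
def mapObjClass (F : C ⥤ D) : ObjClass C → ObjClass D :=
  Quotient.map F.obj (fun _ _ ⟨i⟩ => ⟨F.mapIso i⟩)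

/-- The map `[f] ↦ [F f]` of classes of morphisms induced by a functor. -/
def mapArrowClass (F : C ⥤ D) : ArrowClass C → ArrowClass D :=
  Quotient.map (fun f => Arrow.mk (F.map f.hom)) (by
    rintro f g ⟨i, j, h⟩
    exact ⟨F.mapIso i, F.mapIso j, (F.map_comp f.hom j.hom).symm.trans
      ((congrArg F.map h).trans (F.map_comp i.hom g.hom))⟩)

variable (C)

/-- A coherent choice of one identifying isomorphism between any two isomorphic objects. -/
structure CoherentIsos where
  iso : ∀ {X Y : C}, IsIsomorphic X Y → (X ≅ Y)
  iso_self : ∀ {X : C} (h : IsIsomorphic X X), iso h = Iso.refl X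
  iso_trans : ∀ {X Y Z : C} (h : IsIsomorphic X Y) (h' : IsIsomorphic Y Z)
    (h'' : IsIsomorphic X Z), iso h ≪≫ iso h' = iso h''

lemma CoherentIsos.nonempty : Nonempty (CoherentIsos C) := by
  have key : ∀ X : C, Nonempty (X ≅ (Quotient.mk (isIsomorphicSetoid C) X).out) := fun X =>
    (Quotient.exact (Quotient.out_eq (Quotient.mk (isIsomorphicSetoid C) X)).symm : _)
  have r := fun X => Classical.choice (key X)
  refine ⟨⟨fun {X Y} h => r X ≪≫ eqToIso (congrArg Quotient.out (Quotient.sound h)) ≪≫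
    (r Y).symm, ?_, ?_⟩⟩
  · intro X h
    ext
    simp
  · intro X Y Z h h' h''
    ext
    simp

end Classes

/-- The category obtained from a category `C` by identifying isomorphic objects along the
isomorphisms `σ`. Its objects are the isomorphism classes of `C`, its morphisms are the classes of
morphisms of `C` under the relation `j ∘ f = f' ∘ i`, where `i` and `j` are the identifying
isomorphisms. (With arbitrary isomorphisms `i`, `j` composition would not be well defined.) -/
@[ext]
structure StarCat {C : Type u} [Category.{v} C] (σ : CoherentIsos C) where
  cls : ObjClass C

namespace StarCat

variable {C : Type u} [Category.{v} C] (σ : CoherentIsos C)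

/-- A morphism of `C` from a member of the class `a` to a member of the class `b`. -/
structure Rep (a b : ObjClass C) where
  {src : C}
  {tgt : C}
  src_eq : Quotient.mk (isIsomorphicSetoid C) src = a
  tgt_eq : Quotient.mk (isIsomorphicSetoid C) tgt = b
  hom : src ⟶ tgt

variable {a b c : ObjClass C}

lemma isIso_of {X Y : C} (hX : Quotient.mk (isIsomorphicSetoid C) X = a)
    (hY : Quotient.mk (isIsomorphicSetoid C) Y = a) : IsIsomorphic X Y :=
  Quotient.exact (hX.trans hY.symm)

/-- `f` and `f'` are related if `j ∘ f = f' ∘ i` for the identifying isomorphisms `i` and `j`. -/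
def Rep.setoid (a b : ObjClass C) : Setoid (Rep a b) where
  r f f' := f.hom ≫ (σ.iso (isIso_of f.tgt_eq f'.tgt_eq)).hom =
    (σ.iso (isIso_of f.src_eq f'.src_eq)).hom ≫ f'.hom
  iseqv :=
    { refl := fun f => by simp [σ.iso_self]
      symm := by
        intro f g h
        have e₁ := σ.iso_trans (isIso_of g.src_eq f.src_eq) (isIso_of f.src_eq g.src_eq)
          (isIso_of g.src_eq g.src_eq)
        have e₂ := σ.iso_trans (isIso_of f.tgt_eq g.tgt_eq) (isIso_of g.tgt_eq f.tgt_eq)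
          (isIso_of f.tgt_eq f.tgt_eq)
        rw [σ.iso_self] at e₁ e₂
        have e₁' := congrArg Iso.hom e₁
        have e₂' := congrArg Iso.hom e₂
        simp only [Iso.trans_hom, Iso.refl_hom] at e₁' e₂'
        calc g.hom ≫ (σ.iso (isIso_of g.tgt_eq f.tgt_eq)).hom
            = ((σ.iso (isIso_of g.src_eq f.src_eq)).hom ≫
                (σ.iso (isIso_of f.src_eq g.src_eq)).hom) ≫ g.hom ≫
                (σ.iso (isIso_of g.tgt_eq f.tgt_eq)).hom := by rw [e₁', Category.id_comp]
          _ = (σ.iso (isIso_of g.src_eq f.src_eq)).hom ≫ f.hom := by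
              rw [Category.assoc, ← reassoc_of% h, e₂', Category.comp_id]
      trans := by
        intro f g k h h'
        rw [← σ.iso_trans (isIso_of f.tgt_eq g.tgt_eq) (isIso_of g.tgt_eq k.tgt_eq),
          ← σ.iso_trans (isIso_of f.src_eq g.src_eq) (isIso_of g.src_eq k.src_eq)]
        simp only [Iso.trans_hom, Category.assoc]
        rw [reassoc_of% h, h'] }

/-- Composition of representatives, through the identifying isomorphism in the middle. -/
def Rep.comp (f : Rep a b) (g : Rep b c) : Rep a c :=
  ⟨f.src_eq, g.tgt_eq, f.hom ≫ (σ.iso (isIso_of f.tgt_eq g.src_eq)).hom ≫ g.hom⟩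

lemma Rep.comp_rel {f f' : Rep a b} {g g' : Rep b c} (hf : (Rep.setoid σ a b).r f f')
    (hg : (Rep.setoid σ b c).r g g') : (Rep.setoid σ a c).r (f.comp σ g) (f'.comp σ g') := by
  change (f.hom ≫ (σ.iso (isIso_of f.tgt_eq g.src_eq)).hom ≫ g.hom) ≫
      (σ.iso (isIso_of g.tgt_eq g'.tgt_eq)).hom =
    (σ.iso (isIso_of f.src_eq f'.src_eq)).hom ≫
      f'.hom ≫ (σ.iso (isIso_of f'.tgt_eq g'.src_eq)).hom ≫ g'.hom
  have hf' : f.hom ≫ (σ.iso (isIso_of f.tgt_eq f'.tgt_eq)).hom =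
    (σ.iso (isIso_of f.src_eq f'.src_eq)).hom ≫ f'.hom := hf
  have hg' : g.hom ≫ (σ.iso (isIso_of g.tgt_eq g'.tgt_eq)).hom =
    (σ.iso (isIso_of g.src_eq g'.src_eq)).hom ≫ g'.hom := hg
  have e₁ := congrArg Iso.hom (σ.iso_trans (isIso_of f.tgt_eq g.src_eq)
    (isIso_of g.src_eq g'.src_eq) (isIso_of f.tgt_eq g'.src_eq))
  have e₂ := congrArg Iso.hom (σ.iso_trans (isIso_of f.tgt_eq f'.tgt_eq)
    (isIso_of f'.tgt_eq g'.src_eq) (isIso_of f.tgt_eq g'.src_eq))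
  simp only [Iso.trans_hom] at e₁ e₂
  simp only [Category.assoc]
  refine (congrArg (fun k => f.hom ≫ (σ.iso (isIso_of f.tgt_eq g.src_eq)).hom ≫ k) hg').trans ?_
  refine Eq.trans ?_ ((reassoc_of% hf') _)
  rw [reassoc_of% e₁, reassoc_of% e₂]

/-- Morphisms are the classes of morphisms of `C` under `j ∘ f = f' ∘ i`. -/
noncomputable instance : Category.{max u v} (StarCat σ) where
  Hom a b := Quotient (Rep.setoid σ a.cls b.cls)
  id a := Quotient.mk _ ⟨Quotient.out_eq a.cls, Quotient.out_eq a.cls, 𝟙 _⟩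
  comp f g := Quotient.map₂ (sa := Rep.setoid σ _ _) (sb := Rep.setoid σ _ _)
    (sc := Rep.setoid σ _ _) (Rep.comp σ) (fun _ _ hf _ _ hg => Rep.comp_rel σ hf hg) f g
  id_comp {a b} f := by
    induction f using Quotient.ind with | _ f
    refine Quotient.sound (s := Rep.setoid σ _ _) ?_
    change (𝟙 (Quotient.out a.cls) ≫ (σ.iso (isIso_of (Quotient.out_eq _) f.src_eq)).hom ≫ f.hom) ≫
      (σ.iso (isIso_of f.tgt_eq f.tgt_eq)).hom =
        (σ.iso (isIso_of (Quotient.out_eq _) f.src_eq)).hom ≫ f.hom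
    rw [σ.iso_self, Iso.refl_hom, Category.comp_id, Category.id_comp]
  comp_id {a b} f := by
    induction f using Quotient.ind with | _ f
    refine Quotient.sound (s := Rep.setoid σ _ _) ?_
    change (f.hom ≫ (σ.iso (isIso_of f.tgt_eq (Quotient.out_eq _))).hom ≫
        𝟙 (Quotient.out b.cls)) ≫ (σ.iso (isIso_of (Quotient.out_eq _) f.tgt_eq)).hom =
      (σ.iso (isIso_of f.src_eq f.src_eq)).hom ≫ f.hom
    have e := congrArg Iso.hom (σ.iso_trans
      (isIso_of f.tgt_eq (Quotient.out_eq _)) (isIso_of (Quotient.out_eq _) f.tgt_eq)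
      (isIso_of f.tgt_eq f.tgt_eq))
    simp only [Iso.trans_hom, σ.iso_self, Iso.refl_hom] at e
    rw [σ.iso_self, Iso.refl_hom, Category.id_comp, Category.comp_id, Category.assoc, e,
      Category.comp_id]
  assoc f g h := by
    induction f using Quotient.ind with | _ f
    induction g using Quotient.ind with | _ g
    induction h using Quotient.ind with | _ h
    refine congrArg (Quotient.mk (Rep.setoid σ _ _)) ?_
    simp [Rep.comp]

/-- The class of an object of `C`. -/
def of (X : C) : StarCat σ := ⟨Quotient.mk _ X⟩

/-- The class of a morphism of `C`. -/
def homOf {X Y : C} (f : X ⟶ Y) : of σ X ⟶ of σ Y :=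
  Quotient.mk (Rep.setoid σ _ _) ⟨rfl, rfl, f⟩

variable {σ} in
/-- The class of a representative under arbitrary isomorphisms `i`, `j`. -/
def toArrowClass {a b : StarCat σ} (m : a ⟶ b) : ArrowClass C :=
  Quotient.lift (s := Rep.setoid σ a.cls b.cls) (fun f => arrowClass f.hom)
    (fun _ _ h => Quotient.sound ⟨_, _, h⟩) m

end StarCat

/-- The functor `F` induces an equivalence after passing to isomorphism classes of objects and the
corresponding classes of morphisms: a genuine equivalence of categories when the classes are
formed along coherent systems of isomorphisms, given by `X ↦ F X` and `f ↦ F f` on classes, and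
bijections `[X] ↦ [F X]`, `[f] ↦ [F f]`, respecting and reflecting composition, when the classes
are formed with arbitrary isomorphisms. -/
structure InducesStarEquivalence {C : Type u} [Category.{v} C] {D : Type u'} [Category.{v'} D]
    (F : C ⥤ D) : Prop where
  star : ∀ (σ : CoherentIsos C) (τ : CoherentIsos D), ∃ Ψ : StarCat σ ≌ StarCat τ,
    (∀ a, (Ψ.functor.obj a).cls = mapObjClass F a.cls) ∧
    ∀ {a b : StarCat σ} (m : a ⟶ b),
      StarCat.toArrowClass (Ψ.functor.map m) = mapArrowClass F (StarCat.toArrowClass m)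
  obj_bijective : Function.Bijective (mapObjClass F)
  arrow_bijective : Function.Bijective (mapArrowClass F)
  comp_iff : ∀ a b c : ArrowClass C,
    IsClassComp a b c ↔ IsClassComp (mapArrowClass F a) (mapArrowClass F b) (mapArrowClass F c)

/-! ## Equivalences of categories and isomorphism classes -/

namespace StarCat

variable {C : Type u} [Category.{v} C] (σ : CoherentIsos C)

/-! Both `UltraSpace` and `TreeML` are compared with `TowerML`, by fully faithful functors whose
essential image is exactly the Mittag-Leffler sequences; composing one with a quasi-inverse of the
other relates spaces to trees.

A complete ultrametric space goes to the sequence of its partitions into balls of radius `2 ^ (-n)`.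
A coherent sequence of balls has exactly one common point, by completeness (`exists_eq_ball`), and a
modulus of uniform continuity is precisely the index function of a morphism of sequences; this gives
full faithfulness. A Mittag-Leffler sequence is recovered from its limit with the first-difference
metric: the balls there are the elements that extend to threads, which are the stable images
(`IsML.exists_thread`, `balls_limit_iso`).

A rooted tree goes to the sequence of its integer spheres, with projection towards the root.
Everything rests on `min_gprod_le`, the `0`-hyperbolicity of trees. It makes spheres ultrametric, so
a connected set mapped above height `k` has a single projection to height `k`
(`below_constant_of_preconnected`); hence proper maps act on spheres and homotopic ones act alike.
Conversely, two maps that agree at infinity are both homotopic to the map given by their branching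
point (`homotopic_of_gprod`), and every morphism of sphere sequences is realized by a `1`-Lipschitz
map that climbs slowly enough (`exists_pmap`). This already embeds all rooted trees into Tower-Set,
every sequence comes from a tree (`spheres_tree_iso`), and the two Mittag-Leffler conditions match.

Passing to classes is formal: coherence of the identifying isomorphisms makes the projection of a
category onto its category of classes an equivalence, so any equivalence of categories descends
(`inducesStarEquivalence_of_isEquivalence`). -/

lemma homOf_injective {X Y : C} : Function.Injective (homOf σ : (X ⟶ Y) → _) := by
  intro f g h
  have h' : f ≫ (σ.iso _).hom = (σ.iso _).hom ≫ g := Quotient.exact h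
  simpa [σ.iso_self] using h'

/-- A representative between other members of the two classes is carried to `X ⟶ Y` by conjugation
with the identifying isomorphisms; coherence makes the result equivalent to it. -/
lemma homOf_surjective {X Y : C} : Function.Surjective (homOf σ : (X ⟶ Y) → _) := by
  intro m
  induction m using Quotient.ind with | _ r
  refine ⟨(σ.iso (isIso_of (a := (of σ X).cls) rfl r.src_eq)).hom ≫ r.hom ≫
    (σ.iso (isIso_of (a := (of σ Y).cls) r.tgt_eq rfl)).hom, ?_⟩
  refine Quotient.sound (s := Rep.setoid σ _ _) ?_
  change ((σ.iso _).hom ≫ r.hom ≫ (σ.iso _).hom) ≫ (σ.iso _).hom = (σ.iso _).hom ≫ r.hom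
  have e := congrArg Iso.hom (σ.iso_trans
    (isIso_of (a := (of σ Y).cls) r.tgt_eq rfl) (isIso_of (a := (of σ Y).cls) rfl r.tgt_eq)
    (isIso_of (a := (of σ Y).cls) r.tgt_eq r.tgt_eq))
  simp only [Iso.trans_hom, σ.iso_self, Iso.refl_hom] at e
  rw [Category.assoc, Category.assoc, e, Category.comp_id]

/-- The projection of `C` onto the category of isomorphism classes. -/
noncomputable def proj : C ⥤ StarCat σ where
  obj X := of σ X
  map f := homOf σ f
  map_id X := by
    refine Quotient.sound (s := Rep.setoid σ _ _) ?_
    change 𝟙 X ≫ (σ.iso _).hom = (σ.iso _).hom ≫ 𝟙 _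
    rw [Category.id_comp, Category.comp_id]
  map_comp {X Y Z} f g := by
    refine Quotient.sound (s := Rep.setoid σ _ _) ?_
    have h : ∀ A : C, IsIsomorphic A A := fun A => ⟨Iso.refl A⟩
    change (f ≫ g) ≫ (σ.iso (h Z)).hom = (σ.iso (h X)).hom ≫ f ≫ (σ.iso (h Y)).hom ≫ g
    simp [σ.iso_self]

instance : (proj σ).Faithful := ⟨fun h => homOf_injective σ h⟩

instance : (proj σ).Full := ⟨fun m => homOf_surjective σ m⟩

instance : (proj σ).EssSurj := ⟨fun ⟨a⟩ => by
  induction a using Quotient.ind with | _ X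
  exact ⟨X, ⟨Iso.refl _⟩⟩⟩

instance : (proj σ).IsEquivalence where

variable {σ} in
lemma cls_eq_of_iso {a b : StarCat σ} (i : a ≅ b) : a.cls = b.cls := by
  obtain ⟨a⟩ := a
  obtain ⟨b⟩ := b
  induction a using Quotient.ind with | _ X
  induction b using Quotient.ind with | _ Y
  exact Quotient.sound ⟨(proj σ).preimageIso i⟩

/-- Isomorphisms of the category of classes lift along the fully faithful `proj σ` to isomorphisms
of `C`, and the coarse relation admits arbitrary isomorphisms. -/
lemma toArrowClass_conj {X Y : C} {a b : StarCat σ} (i : (proj σ).obj X ≅ a)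
    (j : (proj σ).obj Y ≅ b) (f : X ⟶ Y) (m : a ⟶ b)
    (h : (proj σ).map f ≫ j.hom = i.hom ≫ m) : toArrowClass m = arrowClass f := by
  obtain ⟨a⟩ := a
  obtain ⟨b⟩ := b
  induction a using Quotient.ind with | _ X'
  induction b using Quotient.ind with | _ Y'
  obtain ⟨g, rfl⟩ := homOf_surjective σ m
  refine Eq.symm (Quotient.sound ⟨(proj σ).preimageIso i, (proj σ).preimageIso j, ?_⟩)
  apply (proj σ).map_injective
  refine ((proj σ).map_comp _ _).trans (Eq.trans ?_ ((proj σ).map_comp _ _).symm)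
  refine (congrArg (_ ≫ ·) ((proj σ).map_preimage _)).trans (h.trans ?_)
  exact congrArg (· ≫ homOf σ g) ((proj σ).map_preimage _).symm

end StarCat

/-! ### Classes of objects and morphisms under an equivalence of categories -/

section

variable {C : Type u} [Category.{v} C] {D : Type u'} [Category.{v'} D] (F : C ⥤ D)

lemma mapArrowClass_arrowClass {X Y : C} (f : X ⟶ Y) :
    mapArrowClass F (arrowClass f) = arrowClass (F.map f) := rfl

lemma arrowClass_eq_of_iso {X Y X' Y' : C} {f : X ⟶ Y} {f' : X' ⟶ Y'} (i : X ≅ X') (j : Y ≅ Y')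
    (h : f ≫ j.hom = i.hom ≫ f') : arrowClass f = arrowClass f' :=
  Quotient.sound ⟨i, j, h⟩

variable [F.IsEquivalence]

lemma mapObjClass_bijective : Function.Bijective (mapObjClass F) := by
  constructor
  · intro a b h
    induction a using Quotient.ind with | _ X
    induction b using Quotient.ind with | _ Y
    obtain ⟨i⟩ := Quotient.exact h
    exact Quotient.sound ⟨F.preimageIso i⟩
  · intro b
    induction b using Quotient.ind with | _ Y
    exact ⟨Quotient.mk _ (F.objPreimage Y), Quotient.sound ⟨F.objObjPreimageIso Y⟩⟩

lemma mapArrowClass_bijective : Function.Bijective (mapArrowClass F) := by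
  constructor
  · intro a b h
    induction a using Quotient.ind with | _ f
    induction b using Quotient.ind with | _ g
    obtain ⟨i, j, e⟩ := Quotient.exact h
    refine Quotient.sound ⟨F.preimageIso (X := f.left) (Y := g.left) i,
      F.preimageIso (X := f.right) (Y := g.right) j, F.map_injective ?_⟩
    simp only [Functor.preimageIso_hom, Functor.map_comp, Functor.map_preimage]
    exact e
  · intro b
    induction b using Quotient.ind with | _ g
    refine ⟨arrowClass (F.preimage ((F.objObjPreimageIso g.left).hom ≫ g.hom ≫
      (F.objObjPreimageIso g.right).inv)), ?_⟩
    refine Quotient.sound ⟨F.objObjPreimageIso g.left, F.objObjPreimageIso g.right, ?_⟩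
    simp

/-- To reflect composites, composable representatives in `D` are pulled back using the same
isomorphism `iY` at the middle object, so that the preimages are still composable. -/
lemma isClassComp_mapArrowClass_iff (a b c : ArrowClass C) :
    IsClassComp (mapArrowClass F a) (mapArrowClass F b) (mapArrowClass F c) ↔
      IsClassComp a b c := by
  constructor
  · rintro ⟨X, Y, Z, f, g, ha, hb, hc⟩
    let iX := F.objObjPreimageIso X
    let iY := F.objObjPreimageIso Y
    let iZ := F.objObjPreimageIso Z
    refine ⟨_, _, _, F.preimage (iX.hom ≫ f ≫ iY.inv), F.preimage (iY.hom ≫ g ≫ iZ.inv),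
      ?_, ?_, ?_⟩
    · apply (mapArrowClass_bijective F).1
      rw [ha, mapArrowClass_arrowClass]
      exact (arrowClass_eq_of_iso iX iY (by simp)).symm
    · apply (mapArrowClass_bijective F).1
      rw [hb, mapArrowClass_arrowClass]
      exact (arrowClass_eq_of_iso iY iZ (by simp)).symm
    · apply (mapArrowClass_bijective F).1
      rw [hc, mapArrowClass_arrowClass]
      exact (arrowClass_eq_of_iso iX iZ (by simp)).symm
  · rintro ⟨X, Y, Z, f, g, rfl, rfl, rfl⟩
    refine ⟨_, _, _, F.map f, F.map g, rfl, rfl, ?_⟩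
    rw [← F.map_comp]
    rfl

/-- An equivalence of categories induces an equivalence on classes. -/
theorem inducesStarEquivalence_of_isEquivalence : InducesStarEquivalence F where
  star σ τ := by
    let K := (StarCat.proj σ).asEquivalence
    refine ⟨K.symm.trans (F.asEquivalence.trans (StarCat.proj τ).asEquivalence), ?_, ?_⟩
    · intro a
      exact congrArg (mapObjClass F) (StarCat.cls_eq_of_iso (K.counitIso.app a))
    · intro a b m
      change mapArrowClass F (arrowClass (K.inverse.map m)) = _
      congr 1
      -- By naturality of the counit, `m` is conjugate to the class of its chosen lift to `C`.
      exact (StarCat.toArrowClass_conj σ (K.counitIso.app a) (K.counitIso.app b)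
        (K.inverse.map m) m (K.counitIso.hom.naturality m)).symm
  obj_bijective := mapObjClass_bijective F
  arrow_bijective := mapArrowClass_bijective F
  comp_iff a b c := (isClassComp_mapArrowClass_iff F a b c).symm

end

/-! ## Complete ultrametric spaces and Mittag-Leffler sequences -/

namespace InvSeq

lemma hom_mk_eq_iff {A B : InvSeq.{u}} (f g : PreHom A B) :
    ((Quotient.mk _ f : A ⟶ B) = Quotient.mk _ g) ↔ PreHom.Rel f g :=
  Quotient.eq

/-- The threads of an inverse sequence. -/
def Thread (A : InvSeq.{u}) : Type u :=
  {x : ∀ n, A.X n // ∀ ⦃n m : ℕ⦄ (h : n ≤ m), A.bond h (x m) = x n}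

/-- In a Mittag-Leffler sequence, stable elements are the components of threads. -/
lemma IsML.exists_thread {A : InvSeq.{u}} (hA : A.IsML) (n : ℕ) :
    ∃ N, ∃ h : n ≤ N, ∀ a : A.X N, ∃ x : A.Thread, x.1 n = A.bond h a := by
  choose N hN hr using hA
  -- A stable element of level `k` comes from a level beyond `N l`, hence from a stable element of
  -- level `l`.
  have key : ∀ {k l : ℕ} (h : k ≤ l) (y : A.X (N k)), ∃ z : A.X (N l),
      A.bond h (A.bond (hN l).le z) = A.bond (hN k).le y := by
    intro k l h y
    have hlt : N k < max (N k) (N l) + 1 := by omega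
    have hy : A.bond (hN k).le y ∈ Set.range (A.bond (hN k).le) := ⟨y, rfl⟩
    rw [← hr k _ hlt] at hy
    obtain ⟨w, hw⟩ := hy
    refine ⟨A.bond (by omega) w, ?_⟩
    rw [← hw, bond_bond, bond_bond]
  refine ⟨N n, (hN n).le, fun a => ?_⟩
  choose s hs using fun k => key (Nat.le_succ (n + k))
  let z : ∀ k, A.X (N (n + k)) := fun k => Nat.rec (motive := fun k => A.X (N (n + k))) a s k
  have step : ∀ k, A.bond (Nat.le_succ (n + k)) (A.bond (hN (n + (k + 1))).le (z (k + 1))) =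
      A.bond (hN (n + k)).le (z k) := fun k => hs k (z k)
  have mono : ∀ {k l : ℕ} (h : k ≤ l), A.bond (Nat.add_le_add_left h n)
      (A.bond (hN (n + l)).le (z l)) = A.bond (hN (n + k)).le (z k) := by
    intro k l h
    induction l, h using Nat.le_induction with
    | base => exact A.bond_self _ _
    | succ l h ih =>
      rw [← ih, ← step l]
      simp only [bond_bond]
  -- Component `j` is projected from level `n + j`, so that one formula also covers the levels below
  -- `n`.
  refine ⟨⟨fun j => A.bond (Nat.le_add_left j n) (A.bond (hN (n + j)).le (z j)), ?_⟩, ?_⟩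
  · intro k l h
    dsimp only
    rw [← mono h]
    simp only [bond_bond]
  · exact (mono (Nat.zero_le n) : _)

section

attribute [local instance] PiNat.dist

/-- The limit of an inverse sequence, with the metric of the first difference. -/
noncomputable instance (A : InvSeq.{u}) : MetricSpace A.Thread where
  dist x y := dist x.1 y.1
  dist_self x := PiNat.dist_self _
  dist_comm x y := PiNat.dist_comm _ _
  dist_triangle x y z := PiNat.dist_triangle _ _ _
  eq_of_dist_eq_zero h := Subtype.ext (PiNat.eq_of_dist_eq_zero _ _ h)

instance (A : InvSeq.{u}) : IsUltrametricDist A.Thread :=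
  ⟨fun x y z => PiNat.dist_triangle_nonarch x.1 y.1 z.1⟩

/-- A component of a thread determines all lower ones, so agreement at `n` puts the first difference
at `n + 1` or later. -/
lemma Thread.dist_lt_iff {A : InvSeq.{u}} {x y : A.Thread} {n : ℕ} :
    dist x y < (1 / 2) ^ n ↔ x.1 n = y.1 n := by
  constructor
  · exact fun h => PiNat.apply_eq_of_dist_lt h le_rfl
  · intro h
    refine lt_of_le_of_lt (b := (1 / 2 : ℝ) ^ (n + 1)) ?_
      (pow_lt_pow_right_of_lt_one₀ (by norm_num) (by norm_num) n.lt_succ_self)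
    refine PiNat.mem_cylinder_iff_dist_le.1 (fun i hi => ?_)
    rw [← x.2 (Nat.lt_succ_iff.1 hi), ← y.2 (Nat.lt_succ_iff.1 hi), h]

instance (A : InvSeq.{u}) : CompleteSpace A.Thread := by
  refine Metric.complete_of_convergent_controlled_sequences (fun n => (1 / 2 : ℝ) ^ n)
    (fun n => by positivity) (fun s hs => ?_)
  have hs' : ∀ n k l, n ≤ k → n ≤ l → (s k).1 n = (s l).1 n := fun n k l hk hl =>
    Thread.dist_lt_iff.1 (hs n k l hk hl)
  -- The limit is the diagonal: from the `n`-th term on, all terms have the same component `n`.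
  refine ⟨⟨fun n => (s n).1 n, fun n m h => ?_⟩, ?_⟩
  · dsimp only
    rw [(s m).2 h, hs' n m n h le_rfl]
  · refine Metric.tendsto_atTop.2 fun ε hε => ?_
    obtain ⟨n, hn⟩ := exists_pow_lt_of_lt_one hε (by norm_num : (1 / 2 : ℝ) < 1)
    refine ⟨n, fun m hm => lt_trans ?_ hn⟩
    exact Thread.dist_lt_iff.2 (hs' n m n hm le_rfl)

/-- The limit of an inverse sequence as an ultrametric space. -/
noncomputable def limit (A : InvSeq.{u}) : UltraSpace.{u} where
  carrier := A.Thread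
  dist_le_one x y := PiNat.dist_le_one x.1 y.1

end

end InvSeq

/-! ### The inverse sequence of balls -/

namespace UltraSpace

/-- Two points are in the same open ball of radius `2 ^ (-n)`. -/
def near (U : UltraSpace.{u}) (n : ℕ) : Setoid U.carrier where
  r x y := dist x y < (1 / 2) ^ n
  iseqv :=
    { refl := fun x => by rw [dist_self]; positivity
      symm := fun h => by rwa [dist_comm]
      trans := fun h h' => (dist_triangle_max _ _ _).trans_lt (max_lt h h') }

/-- The inverse sequence of the partitions into open balls of radius `2 ^ (-n)`. -/
def balls (U : UltraSpace.{u}) : InvSeq.{u} where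
  X n := Quotient (U.near n)
  bond _ _ h := Quotient.map _root_.id fun _ _ e =>
    e.trans_le (pow_le_pow_of_le_one (by norm_num) (by norm_num) h)
  system :=
    { map_self := fun _ x => by induction x using Quotient.ind; rfl
      map_map := fun _ _ _ _ _ x => by induction x using Quotient.ind; rfl }

/-- The ball of radius `2 ^ (-n)` around a point. -/
def ball (U : UltraSpace.{u}) (n : ℕ) (x : U.carrier) : U.balls.X n := Quotient.mk (U.near n) x

variable {U W : UltraSpace.{u}}

lemma ball_surjective (n : ℕ) : Function.Surjective (U.ball n) := Quotient.mk_surjective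

lemma bond_ball {n m : ℕ} (h : n ≤ m) (x : U.carrier) :
    U.balls.bond h (U.ball m x) = U.ball n x := rfl

lemma ball_eq_iff {n : ℕ} {x y : U.carrier} :
    U.ball n x = U.ball n y ↔ dist x y < (1 / 2) ^ n :=
  Quotient.eq (r := U.near n)

lemma eq_of_ball_eq {x y : U.carrier} (h : ∀ n, U.ball n x = U.ball n y) : x = y := by
  by_contra hne
  obtain ⟨n, hn⟩ := exists_pow_lt_of_lt_one (dist_pos.2 hne) (by norm_num : (1 / 2 : ℝ) < 1)
  exact (hn.trans (ball_eq_iff.1 (h n))).false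

lemma balls_isML (U : UltraSpace.{u}) : U.balls.IsML := by
  have hs : ∀ {n m : ℕ} (h : n ≤ m), Set.range (U.balls.bond h) = Set.univ := by
    intro n m h
    refine Set.eq_univ_of_forall fun y => ?_
    obtain ⟨x, rfl⟩ := ball_surjective n y
    exact ⟨U.ball m x, rfl⟩
  exact fun n => ⟨n + 1, n.lt_succ_self, fun m h => by rw [hs, hs]⟩

/-- Together with `uniformContinuous_of_modulus`, this turns uniform continuity into the existence
of an index function. -/
lemma exists_ball_modulus {f : U.carrier → W.carrier} (hf : UniformContinuous f) (n : ℕ) :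
    ∃ m, ∀ x y, U.ball m x = U.ball m y → W.ball n (f x) = W.ball n (f y) := by
  obtain ⟨δ, hδ, h⟩ := Metric.uniformContinuous_iff.1 hf ((1 / 2) ^ n) (by positivity)
  obtain ⟨m, hm⟩ := exists_pow_lt_of_lt_one hδ (by norm_num : (1 / 2 : ℝ) < 1)
  exact ⟨m, fun x y e => ball_eq_iff.2 (h ((ball_eq_iff.1 e).trans hm))⟩

lemma uniformContinuous_of_modulus {f : U.carrier → W.carrier}
    (h : ∀ n, ∃ m, ∀ x y, U.ball m x = U.ball m y → W.ball n (f x) = W.ball n (f y)) :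
    UniformContinuous f := by
  refine Metric.uniformContinuous_iff.2 fun ε hε => ?_
  obtain ⟨n, hn⟩ := exists_pow_lt_of_lt_one hε (by norm_num : (1 / 2 : ℝ) < 1)
  obtain ⟨m, hm⟩ := h n
  exact ⟨(1 / 2) ^ m, by positivity, fun {x y} e =>
    (ball_eq_iff.1 (hm x y (ball_eq_iff.2 e))).trans hn⟩

/-- Completeness enters here: points chosen from nested balls form a Cauchy sequence, and the limit
stays in every ball because two points closer than the radius have the same ball. -/
lemma exists_eq_ball (s : ∀ n, U.balls.X n)
    (hs : ∀ ⦃n m : ℕ⦄ (h : n ≤ m), U.balls.bond h (s m) = s n) :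
    ∃ x, ∀ n, U.ball n x = s n := by
  choose t ht using fun n => ball_surjective n (s n)
  have ht' : ∀ {n m : ℕ}, n ≤ m → U.ball n (t m) = s n := fun {n m} h => by
    rw [← hs h, ← ht m, bond_ball]
  have hc : CauchySeq t := Metric.cauchySeq_iff'.2 fun ε hε => by
    obtain ⟨n, hn⟩ := exists_pow_lt_of_lt_one hε (by norm_num : (1 / 2 : ℝ) < 1)
    exact ⟨n, fun m hm => (ball_eq_iff.1 ((ht' hm).trans (ht n).symm)).trans hn⟩
  obtain ⟨x, hx⟩ := cauchySeq_tendsto_of_complete hc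
  refine ⟨x, fun n => ?_⟩
  obtain ⟨k, hk⟩ := Metric.tendsto_atTop.1 hx ((1 / 2) ^ n) (by positivity)
  rw [← ht' (le_max_left n k), eq_comm]
  exact ball_eq_iff.2 (hk _ (le_max_right n k))

/-- A uniformly continuous map induces a morphism of the sequences of balls. -/
noncomputable def ballsMap (f : U ⟶ W) : InvSeq.PreHom U.balls W.balls where
  Φ n := (exists_ball_modulus f.2 n).choose
  f n := Quotient.lift (fun x => W.ball n (f.1 x)) fun x y h =>
    (exists_ball_modulus f.2 n).choose_spec x y (Quotient.sound h)
  comm n n' _ := ⟨max _ _, le_max_left _ _, le_max_right _ _, fun x => by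
    obtain ⟨x, rfl⟩ := ball_surjective _ x
    rfl⟩

/-- Complete ultrametric spaces as inverse sequences. -/
noncomputable def toInvSeq : UltraSpace.{u} ⥤ InvSeq.{u} where
  obj U := U.balls
  map f := Quotient.mk _ (ballsMap f)
  map_id U := (InvSeq.hom_mk_eq_iff _ _).2 fun n =>
    ⟨max _ _, le_max_left _ _, le_max_right _ _, fun x => by
      obtain ⟨x, rfl⟩ := ball_surjective _ x
      rfl⟩
  map_comp f g := (InvSeq.hom_mk_eq_iff _ _).2 fun n =>
    ⟨max _ _, le_max_left _ _, le_max_right _ _, fun x => by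
      obtain ⟨x, rfl⟩ := ball_surjective _ x
      rfl⟩

instance : toInvSeq.{u}.Faithful where
  map_injective {U W f g} h := by
    refine Subtype.ext (funext fun x => eq_of_ball_eq fun n => ?_)
    obtain ⟨m, h₁, h₂, e⟩ := (InvSeq.hom_mk_eq_iff _ _).1 h n
    exact e (U.ball m x)

instance : toInvSeq.{u}.Full where
  map_surjective {U W} F := by
    induction F using Quotient.ind with | _ F
    -- The components of `F` along the balls around `x` form a coherent sequence of balls, which
    -- determines the image of `x`.
    have hs : ∀ x, ∃ y, ∀ n, W.ball n y = F.f n (U.ball _ x) := fun x => by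
      refine exists_eq_ball _ fun n m h => ?_
      obtain ⟨k, h₁, h₂, e⟩ := F.comm_le h
      exact (e (U.ball k x)).symm
    choose f hf using hs
    refine ⟨⟨f, uniformContinuous_of_modulus fun n => ⟨F.Φ n, fun x y h => ?_⟩⟩, ?_⟩
    · rw [hf, hf, h]
    · refine (InvSeq.hom_mk_eq_iff _ _).2 fun n => ⟨max _ _, le_max_left _ _, le_max_right _ _,
        fun x => ?_⟩
      obtain ⟨x, rfl⟩ := ball_surjective _ x
      exact hf x n

/-- The sequence of balls of the limit of a Mittag-Leffler sequence is isomorphic to it. -/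
lemma balls_limit_iso {A : InvSeq.{u}} (hA : A.IsML) : Nonempty (A.limit.balls ≅ A) := by
  choose N hN t ht using fun n => hA.exists_thread n
  -- The level-`n` balls of the limit correspond to the elements of `A.X n` lying on threads.
  have inj : ∀ {n : ℕ} {x y : A.Thread}, A.limit.ball n x = A.limit.ball n y ↔ x.1 n = y.1 n :=
    fun {n x y} => ball_eq_iff.trans InvSeq.Thread.dist_lt_iff
  let F : InvSeq.PreHom A.limit.balls A :=
    { Φ := fun n => n
      f := fun n => Quotient.lift (fun x : A.Thread => x.1 n) fun x y h =>
        inj.1 (Quotient.sound h)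
      comm := fun n m h => ⟨m, h.le, le_rfl, fun x => by
        obtain ⟨x, rfl⟩ := ball_surjective _ x
        exact (x.2 h.le).symm⟩ }
  -- Only elements coming from level `N n` are known to lie on threads at level `n`, hence the index
  -- function `N`.
  let G : InvSeq.PreHom A A.limit.balls :=
    { Φ := N
      f := fun n a => A.limit.ball n (t n a)
      comm := fun n m h => ⟨max (N n) (N m), le_max_left _ _, le_max_right _ _, fun a => by
        refine (inj (x := t n _) (y := t m _)).2 ?_
        rw [ht, ← (t m _).2 h.le, ht]
        simp only [InvSeq.bond_bond]⟩ }
  refine ⟨⟨Quotient.mk _ F, Quotient.mk _ G, ?_, ?_⟩⟩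
  · refine (InvSeq.hom_mk_eq_iff (F.comp G) (InvSeq.PreHom.id _)).2 fun n =>
      ⟨N n, le_rfl, hN n, fun x => ?_⟩
    obtain ⟨x, rfl⟩ := ball_surjective _ x
    refine (inj (x := t n (x.1 (N n))) (y := x)).2 ?_
    rw [ht, x.2]
  · refine (InvSeq.hom_mk_eq_iff (G.comp F) (InvSeq.PreHom.id _)).2 fun n =>
      ⟨N n, le_rfl, hN n, fun a => ?_⟩
    exact (ht n _).trans (A.bond_bond _ _ _)

/-- Complete ultrametric spaces as Mittag-Leffler sequences. -/
noncomputable def toTowerML : UltraSpace.{u} ⥤ TowerML.{u} :=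
  ObjectProperty.lift _ toInvSeq balls_isML

instance : toTowerML.{u}.Faithful where
  map_injective {X Y _ _} h := toInvSeq.map_injective
    (congrArg (fun k : toTowerML.obj X ⟶ toTowerML.obj Y => k.hom) h)

instance : toTowerML.{u}.Full where
  map_surjective F := by
    obtain ⟨f, hf⟩ := toInvSeq.map_surjective F.hom
    exact ⟨f, ObjectProperty.hom_ext _ hf⟩

instance : toTowerML.{u}.EssSurj where
  mem_essImage A := by
    obtain ⟨i⟩ := balls_limit_iso A.property
    exact ⟨A.obj.limit, ⟨(ObjectProperty.fullyFaithfulι _).preimageIso i⟩⟩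

instance : toTowerML.{u}.IsEquivalence where

end UltraSpace

/-! ## Rooted trees described by heights and parents -/

/-- A set with a height function and a parent map decreasing the height by one, such that the root
is the only element of height zero. -/
structure Ancestry (V : Type u) where
  ht : V → ℕ
  par : V → V
  root : V
  ht_par : ∀ a, ht (par a) = ht a - 1
  ht_eq_zero : ∀ a, ht a = 0 ↔ a = root

namespace Ancestry

variable {V : Type u} (P : Ancestry V)

lemma ht_iterate (n : ℕ) (a : V) : P.ht (P.par^[n] a) = P.ht a - n := by
  induction n generalizing a with
  | zero => rfl
  | succ n ih => rw [Function.iterate_succ_apply, ih, P.ht_par]; omega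

/-- The ancestor of height `k`, or the point itself if its height is at most `k`. -/
def anc (a : V) (k : ℕ) : V := P.par^[P.ht a - k] a

lemma ht_anc {a : V} {k : ℕ} (h : k ≤ P.ht a) : P.ht (P.anc a k) = k := by
  rw [anc, ht_iterate]; omega

lemma anc_of_le {a : V} {k : ℕ} (h : P.ht a ≤ k) : P.anc a k = a := by
  rw [anc, Nat.sub_eq_zero_of_le h]; rfl

lemma anc_anc {a : V} {k l : ℕ} (h : k ≤ l) : P.anc (P.anc a l) k = P.anc a k := by
  rcases le_total (P.ht a) l with h' | h'
  · rw [P.anc_of_le h']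
  · rw [anc, P.ht_anc h', anc, anc, ← Function.iterate_add_apply]
    congr 2
    omega

lemma anc_par {a : V} {k : ℕ} (h : k < P.ht a) : P.anc (P.par a) k = P.anc a k := by
  rw [anc, anc, P.ht_par, ← Function.iterate_succ_apply]
  congr 2
  omega

lemma anc_zero (a : V) : P.anc a 0 = P.root :=
  (P.ht_eq_zero _).1 (P.ht_anc (Nat.zero_le _))

open Classical in
/-- The height at which the ancestral lines of two points meet. -/
noncomputable def meet (a b : V) : ℕ :=
  Nat.findGreatest (fun k => P.anc a k = P.anc b k) (min (P.ht a) (P.ht b))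

/-- The heights at which two ancestral lines agree form an initial segment, since equal ancestors
have equal ancestors. This characterization yields the other formulas for `meet`. -/
lemma le_meet_iff {a b : V} {k : ℕ} :
    k ≤ P.meet a b ↔ k ≤ P.ht a ∧ k ≤ P.ht b ∧ P.anc a k = P.anc b k := by
  classical
  have hm : P.anc a (P.meet a b) = P.anc b (P.meet a b) :=
    Nat.findGreatest_spec (P := fun k => P.anc a k = P.anc b k) (Nat.zero_le _)
      (by rw [anc_zero, anc_zero])
  have hle : P.meet a b ≤ min (P.ht a) (P.ht b) := Nat.findGreatest_le _
  constructor
  · intro h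
    refine ⟨by omega, by omega, ?_⟩
    rw [← P.anc_anc h, hm, P.anc_anc h]
  · rintro ⟨h₁, h₂, h₃⟩
    exact Nat.le_findGreatest (le_min h₁ h₂) h₃

lemma meet_le_left (a b : V) : P.meet a b ≤ P.ht a := (P.le_meet_iff.1 le_rfl).1

lemma meet_le_right (a b : V) : P.meet a b ≤ P.ht b := (P.le_meet_iff.1 le_rfl).2.1

lemma meet_comm (a b : V) : P.meet a b = P.meet b a :=
  eq_of_forall_le_iff fun k => by
    rw [le_meet_iff, le_meet_iff, eq_comm]; tauto

lemma meet_self (a : V) : P.meet a a = P.ht a :=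
  eq_of_forall_le_iff fun k => by rw [le_meet_iff]; tauto

/-- The combinatorial form of `0`-hyperbolicity, from transitivity of having the same ancestor. -/
lemma min_meet_le (a b c : V) : min (P.meet a b) (P.meet b c) ≤ P.meet a c := by
  obtain ⟨h₁, -, h₂⟩ := P.le_meet_iff.1 (min_le_left (P.meet a b) (P.meet b c))
  obtain ⟨-, h₃, h₄⟩ := P.le_meet_iff.1 (min_le_right (P.meet a b) (P.meet b c))
  exact P.le_meet_iff.2 ⟨h₁, h₃, h₂.trans h₄⟩

lemma meet_anc_left (a b : V) (k : ℕ) : P.meet (P.anc a k) b = min k (P.meet a b) := by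
  rcases le_total (P.ht a) k with h | h
  · rw [P.anc_of_le h, min_eq_right ((P.meet_le_left a b).trans h)]
  · refine eq_of_forall_le_iff fun l => ?_
    rw [le_min_iff, le_meet_iff, le_meet_iff, P.ht_anc h]
    constructor
    · rintro ⟨h₁, h₂, h₃⟩
      exact ⟨h₁, h₁.trans h, h₂, by rw [← h₃, P.anc_anc h₁]⟩
    · rintro ⟨h₁, h₂, h₃, h₄⟩
      exact ⟨h₁, h₃, by rw [P.anc_anc h₁, h₄]⟩

lemma par_eq_anc {a : V} (h : 0 < P.ht a) : P.par a = P.anc a (P.ht a - 1) := by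
  rw [anc, Nat.sub_sub_self h]; rfl

lemma meet_par_left {a : V} (h : 0 < P.ht a) (b : V) :
    P.meet (P.par a) b = min (P.ht a - 1) (P.meet a b) := by
  rw [P.par_eq_anc h, meet_anc_left]

lemma meet_par_right {b : V} (h : 0 < P.ht b) (a : V) :
    P.meet a (P.par b) = min (P.ht b - 1) (P.meet a b) := by
  rw [P.meet_comm, P.meet_par_left h, P.meet_comm]

lemma eq_of_meet_eq {a b : V} (h₁ : P.meet a b = P.ht a) (h₂ : P.meet a b = P.ht b) : a = b := by
  have h := (P.le_meet_iff.1 (le_refl (P.meet a b))).2.2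
  rwa [P.anc_of_le h₁.ge, P.anc_of_le h₂.ge] at h

/-- The graph `G` joins each point other than the root to its parent. -/
def IsGraph (G : SimpleGraph V) : Prop :=
  ∀ a b, G.Adj a b ↔ (0 < P.ht a ∧ P.par a = b) ∨ (0 < P.ht b ∧ P.par b = a)

/-- The graph which joins each point other than the root to its parent. -/
def graph : SimpleGraph V where
  Adj a b := (0 < P.ht a ∧ P.par a = b) ∨ (0 < P.ht b ∧ P.par b = a)
  symm := ⟨fun _ _ h => h.symm⟩
  loopless := ⟨fun a h => by
    have := P.ht_par a
    rcases h with ⟨h₁, h₂⟩ | ⟨h₁, h₂⟩ <;> rw [h₂] at this <;> omega⟩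

lemma isGraph_graph : P.IsGraph P.graph := fun _ _ => Iff.rfl

variable {P} {G : SimpleGraph V}

lemma IsGraph.adj_par (hG : P.IsGraph G) {a : V} (h : 0 < P.ht a) : G.Adj (P.par a) a :=
  (hG _ _).2 (Or.inr ⟨h, rfl⟩)

lemma IsGraph.exists_walk_iterate (hG : P.IsGraph G) (n : ℕ) {a b : V} (h : n ≤ P.ht a)
    (hb : P.par^[n] a = b) : ∃ w : G.Walk a b, w.length = n := by
  induction n generalizing a with
  | zero =>
    subst hb
    exact ⟨SimpleGraph.Walk.nil, rfl⟩
  | succ n ih =>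
    obtain ⟨w, hw⟩ := ih (a := P.par a) (by rw [P.ht_par]; omega) hb
    exact ⟨SimpleGraph.Walk.cons (hG.adj_par (by omega)).symm w, by
      rw [SimpleGraph.Walk.length_cons, hw]⟩

lemma IsGraph.exists_walk_anc (hG : P.IsGraph G) (a : V) (k : ℕ) :
    ∃ w : G.Walk a (P.anc a k), w.length = P.ht a - k :=
  hG.exists_walk_iterate _ (Nat.sub_le _ _) rfl

lemma IsGraph.connected (hG : P.IsGraph G) : G.Connected := by
  have h : ∀ a, G.Reachable a P.root := fun a => by
    obtain ⟨w, -⟩ := hG.exists_walk_anc a 0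
    rw [← P.anc_zero a]
    exact ⟨w⟩
  have : Nonempty V := ⟨P.root⟩
  exact ⟨fun a b => (h a).trans (h b).symm⟩

/-- With `b` fixed, `P.ht x - 2 * P.meet x b` changes by at most one along an edge, and at `x = b`
it equals `-P.ht b`. -/
lemma IsGraph.ht_add_ht_le (hG : P.IsGraph G) {a b : V} (w : G.Walk a b) :
    P.ht a + P.ht b ≤ w.length + 2 * P.meet a b := by
  induction w with
  | nil => rw [meet_self]; omega
  | @cons a c b h w ih =>
    rw [SimpleGraph.Walk.length_cons]
    rcases (hG _ _).1 h with ⟨ha, rfl⟩ | ⟨hc, rfl⟩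
    · have h₁ := P.meet_le_left a b
      rw [P.ht_par, P.meet_par_left ha] at ih
      omega
    · have h₁ := P.meet_le_left c b
      rw [P.ht_par, P.meet_par_left hc]
      omega

lemma IsGraph.dist_eq (hG : P.IsGraph G) (a b : V) :
    G.dist a b + 2 * P.meet a b = P.ht a + P.ht b := by
  apply le_antisymm
  · obtain ⟨w, hw⟩ := hG.exists_walk_anc a (P.meet a b)
    obtain ⟨w', hw'⟩ := hG.exists_walk_anc b (P.meet a b)
    obtain ⟨h₁, h₂, h₃⟩ := P.le_meet_iff.1 (le_refl (P.meet a b))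
    have := SimpleGraph.dist_le (w.append (w'.reverse.copy h₃.symm rfl))
    rw [SimpleGraph.Walk.length_append, SimpleGraph.Walk.length_copy,
      SimpleGraph.Walk.length_reverse, hw, hw'] at this
    omega
  · obtain ⟨w, hw⟩ := hG.connected.exists_walk_length_eq_dist a b
    rw [← hw]
    exact hG.ht_add_ht_le w

/-- Each edge from `a` to its parent is a bridge: the descendants of `a`, described by `P.meet a x =
P.ht a`, are closed under all other edges and do not include the parent. -/
lemma IsGraph.isTree (hG : P.IsGraph G) : G.IsTree := by
  refine ⟨hG.connected, SimpleGraph.isAcyclic_iff_forall_adj_isBridge.2 ?_⟩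
  have key : ∀ a, 0 < P.ht a → G.IsBridge s(a, P.par a) := by
    intro a ha
    have inv : ∀ x, 0 < P.ht x → x ≠ a → (P.meet a x = P.ht a ↔ P.meet a (P.par x) = P.ht a) := by
      intro x hx hne
      rw [P.meet_par_right hx]
      have h₁ := P.meet_le_right a x
      constructor
      · intro h
        by_contra h'
        exact hne (P.eq_of_meet_eq h (by omega)).symm
      · have h₂ := P.meet_le_left a x
        omega
    rw [SimpleGraph.isBridge_iff]
    rintro ⟨w⟩
    have hw : ∀ {x y : V} (w : (G.deleteEdges {s(a, P.par a)}).Walk x y),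
        P.meet a x = P.ht a ↔ P.meet a y = P.ht a := by
      intro x y w
      induction w with
      | nil => rfl
      | @cons x y z h w ih =>
        rw [← ih]
        rw [SimpleGraph.deleteEdges_adj, Set.mem_singleton_iff] at h
        rcases (hG _ _).1 h.1 with ⟨hx, rfl⟩ | ⟨hy, rfl⟩
        · exact inv x hx (by rintro rfl; exact h.2 rfl)
        · exact (inv y hy (by rintro rfl; exact h.2 Sym2.eq_swap)).symm
    have := (hw w).1 (P.meet_self a)
    rw [P.meet_par_right ha, P.meet_self] at this
    omega
  intro a b hab
  rcases (hG _ _).1 hab with ⟨h, rfl⟩ | ⟨h, rfl⟩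
  · exact key _ h
  · rw [Sym2.eq_swap]
    exact key _ h

/-- The distance of two points at heights `h` and `k` on different edges. -/
lemma IsGraph.edge_dist_eq (hG : P.IsGraph G) {a c : V} (ha : 0 < P.ht a) (hc : 0 < P.ht c)
    (hne : a ≠ c) {s t : ℝ} (hs : s ∈ Set.Icc (0 : ℝ) 1) (ht : t ∈ Set.Icc (0 : ℝ) 1) :
    min (min (s + G.dist (P.par a) (P.par c) + t) (s + G.dist (P.par a) c + (1 - t)))
        (min ((1 - s) + G.dist a (P.par c) + t) ((1 - s) + G.dist a c + (1 - t))) =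
      (P.ht a - 1 + s) + (P.ht c - 1 + t) -
        2 * min (P.ht a - 1 + s) (min (P.ht c - 1 + t) (P.meet a c)) := by
  obtain ⟨hs₀, hs₁⟩ := hs
  obtain ⟨ht₀, ht₁⟩ := ht
  have e₁ := hG.dist_eq (P.par a) (P.par c)
  have e₂ := hG.dist_eq (P.par a) c
  have e₃ := hG.dist_eq a (P.par c)
  have e₄ := hG.dist_eq a c
  rw [P.meet_par_left ha, P.meet_par_right hc, P.ht_par, P.ht_par] at e₁
  rw [P.meet_par_left ha, P.ht_par] at e₂
  rw [P.meet_par_right hc, P.ht_par] at e₃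
  have l₁ := P.meet_le_left a c
  have l₂ := P.meet_le_right a c
  -- Either one vertex is a proper ancestor of the other, or the lines separate strictly below both;
  -- `a ≠ c` excludes the rest.
  have hm : P.meet a c = P.ht a ∧ P.meet a c + 1 ≤ P.ht c ∨
      P.meet a c = P.ht c ∧ P.meet a c + 1 ≤ P.ht a ∨
      P.meet a c + 1 ≤ P.ht a ∧ P.meet a c + 1 ≤ P.ht c := by
    by_contra h
    exact hne (P.eq_of_meet_eq (by omega) (by omega))
  generalize P.meet a c = m at *
  generalize P.ht a = A at *
  generalize P.ht c = C at *
  generalize G.dist (P.par a) (P.par c) = d₁ at *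
  generalize G.dist (P.par a) c = d₂ at *
  generalize G.dist a (P.par c) = d₃ at *
  generalize G.dist a c = d₄ at *
  rcases hm with ⟨h, h'⟩ | ⟨h, h'⟩ | ⟨h, h'⟩
  · have f₁ : (d₁ : ℝ) + A = C := by norm_cast; omega
    have f₂ : (d₂ : ℝ) + A = C + 1 := by norm_cast; omega
    have f₃ : (d₃ : ℝ) + A + 1 = C := by norm_cast; omega
    have f₄ : (d₄ : ℝ) + A = C := by norm_cast; omega
    have f₅ : (A : ℝ) + 1 ≤ C := by norm_cast; omega
    subst h
    grind
  · have f₁ : (d₁ : ℝ) + C = A := by norm_cast; omega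
    have f₂ : (d₂ : ℝ) + C + 1 = A := by norm_cast; omega
    have f₃ : (d₃ : ℝ) + C = A + 1 := by norm_cast; omega
    have f₄ : (d₄ : ℝ) + C = A := by norm_cast; omega
    have f₅ : (C : ℝ) + 1 ≤ A := by norm_cast; omega
    subst h
    grind
  · have f₁ : (d₁ : ℝ) + 2 * m + 2 = A + C := by norm_cast; omega
    have f₂ : (d₂ : ℝ) + 2 * m + 1 = A + C := by norm_cast; omega
    have f₃ : (d₃ : ℝ) + 2 * m + 1 = A + C := by norm_cast; omega
    have f₄ : (d₄ : ℝ) + 2 * m = A + C := by norm_cast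
    have f₅ : (m : ℝ) + 1 ≤ A := by norm_cast
    have f₆ : (m : ℝ) + 1 ≤ C := by norm_cast
    grind

end Ancestry

/-- A tree with a chosen vertex, described by heights and parents. -/
lemma SimpleGraph.IsTree.exists_ancestry {V : Type u} {G : SimpleGraph V} (hG : G.IsTree) (v : V) :
    ∃ P : Ancestry V, P.root = v ∧ P.IsGraph G := by
  classical
  -- The parent is the penultimate vertex of a shortest walk from `v`; the root is its own parent.
  have hpar : ∀ a, ∃ b, (a = v ∧ b = v) ∨ (G.Adj a b ∧ G.dist v a = G.dist v b + 1) := by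
    intro a
    by_cases h : a = v
    · exact ⟨v, Or.inl ⟨h, rfl⟩⟩
    · obtain ⟨p, hp⟩ := hG.connected.exists_walk_length_eq_dist v a
      have hn : ¬ p.Nil := SimpleGraph.Walk.not_nil_of_ne (Ne.symm h)
      have hadj := p.adj_penultimate hn
      refine ⟨p.penultimate, Or.inr ⟨hadj.symm, ?_⟩⟩
      have h₁ := SimpleGraph.dist_le p.dropLast
      have h₂ : p.dropLast.length + 1 = p.length := by
        simpa using SimpleGraph.Walk.length_dropLast_add_one hn
      rcases hG.dist_eq_dist_add_one_of_adj v hadj with h₃ | h₃ <;> omega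
  -- Two neighbours nearer to `v` would give two paths from `v` to `a`.
  have huniq : ∀ a b c, G.Adj a b → G.dist v a = G.dist v b + 1 → G.Adj a c →
      G.dist v a = G.dist v c + 1 → b = c := by
    have hp : ∀ a b, G.Adj a b → G.dist v a = G.dist v b + 1 →
        ∃ p : G.Path v a, p.1.penultimate = b := by
      intro a b hab hd
      obtain ⟨p, hp⟩ := hG.connected.exists_walk_length_eq_dist v b
      exact ⟨⟨p.concat hab.symm, SimpleGraph.Walk.isPath_of_length_eq_dist _ (by
        rw [SimpleGraph.Walk.length_concat, hp, hd])⟩, SimpleGraph.Walk.penultimate_concat _ _⟩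
    intro a b c h₁ h₂ h₃ h₄
    obtain ⟨p, rfl⟩ := hp a b h₁ h₂
    obtain ⟨q, rfl⟩ := hp a c h₃ h₄
    rw [(hG.isAcyclic.subsingleton_path v a).elim p q]
  choose par hpar using hpar
  have hz : ∀ a, G.dist v a = 0 ↔ a = v := fun a => by
    rw [hG.connected.dist_eq_zero_iff, eq_comm]
  refine ⟨⟨fun a => G.dist v a, par, v, fun a => ?_, hz⟩, rfl, fun a b => ?_⟩
  · rcases hpar a with ⟨rfl, h⟩ | ⟨-, h⟩
    · rw [h, (hz a).2 rfl]
    · omega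
  · have hpos : ∀ a, 0 < G.dist v a → G.Adj a (par a) ∧ G.dist v a = G.dist v (par a) + 1 := by
      intro a ha
      rcases hpar a with ⟨h, -⟩ | h
      · rw [(hz a).2 h] at ha
        exact (lt_irrefl _ ha).elim
      · exact h
    constructor
    · intro h
      rcases hG.dist_eq_dist_add_one_of_adj v h with h' | h'
      · have ha : 0 < G.dist v a := by omega
        exact Or.inl ⟨ha, huniq a _ _ (hpos a ha).1 (hpos a ha).2 h h'⟩
      · have hb : 0 < G.dist v b := by omega
        exact Or.inr ⟨hb, huniq b _ _ (hpos b hb).1 (hpos b hb).2 h.symm h'⟩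
    · rintro (⟨h, rfl⟩ | ⟨h, rfl⟩)
      · exact (hpos a h).1
      · exact (hpos b h).1.symm

/-! ## Gromov products and segments in rooted simplicial trees -/

namespace IsUnitRealization

variable {V T : Type u} {e : V → V → ℝ → T} {P : Ancestry V}

/-- The point `x` lies at height `h` on the edge from `a` to its parent. -/
def IsCoord (P : Ancestry V) (e : V → V → ℝ → T) (a : V) (h : ℝ) (x : T) : Prop :=
  0 < P.ht a ∧ ∃ s ∈ Set.Icc (0 : ℝ) 1, h = P.ht a - 1 + s ∧ x = e (P.par a) a s

lemma IsCoord.nonneg {a : V} {h : ℝ} {x : T} (hx : IsCoord P e a h x) : 0 ≤ h := by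
  obtain ⟨h₁, s, hs, rfl, -⟩ := hx
  have : (1 : ℝ) ≤ P.ht a := by exact_mod_cast h₁
  linarith [hs.1]

lemma IsCoord.le_ht {a : V} {h : ℝ} {x : T} (hx : IsCoord P e a h x) : h ≤ P.ht a := by
  obtain ⟨h₁, s, hs, rfl, -⟩ := hx
  linarith [hs.2]

variable [MetricSpace T] {G : SimpleGraph V} {ι : V → T}

variable (H : IsUnitRealization G ι e) (hG : P.IsGraph G)

include H hG

lemma dist_coord {a b : V} {h k : ℝ} {x y : T} (hx : IsCoord P e a h x)
    (hy : IsCoord P e b k y) : dist x y = h + k - 2 * min h (min k (P.meet a b)) := by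
  have hh := hx.le_ht
  have hk := hy.le_ht
  obtain ⟨ha, s, hs, rfl, rfl⟩ := hx
  obtain ⟨hb, t, ht, rfl, rfl⟩ := hy
  by_cases hab : a = b
  · subst hab
    rw [H.dist_edge _ _ (hG.adj_par ha) s hs t ht, P.meet_self, min_eq_left hk]
    rcases le_total s t with h | h
    · rw [abs_of_nonpos (by linarith), min_eq_left (by linarith)]
      ring
    · rw [abs_of_nonneg (by linarith), min_eq_right (by linarith)]
      ring
  · rw [H.dist_edges _ _ _ _ (hG.adj_par ha) (hG.adj_par hb) ?_ s hs t ht,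
      hG.edge_dist_eq ha hb hab hs ht]
    intro he
    rcases Sym2.eq_iff.1 he with ⟨-, h⟩ | ⟨h₁, h₂⟩
    · exact hab h
    · have e₁ := P.ht_par a
      have e₂ := P.ht_par b
      rw [h₁] at e₁
      rw [← h₂] at e₂
      omega

lemma isCoord_vertex {a : V} (ha : 0 < P.ht a) : IsCoord P e a (P.ht a) (ι a) := by
  refine ⟨ha, 1, by simp, by ring, ?_⟩
  have h := hG.adj_par ha
  rw [← H.edge_zero _ _ h.symm, H.edge_symm _ _ h 0 (by simp), sub_zero]

/-- The root has no edge to a parent, so it is described as the lower end of an edge issuing from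
it. -/
lemma isCoord_root {a : V} (ha : 0 < P.ht a) : IsCoord P e (P.anc a 1) 0 (ι P.root) := by
  have h₁ := P.ht_anc (a := a) (k := 1) ha
  have h₂ : P.par (P.anc a 1) = P.root := by
    rw [P.par_eq_anc (by omega), h₁]
    exact P.anc_zero _
  refine ⟨by omega, 0, by simp, by rw [h₁]; simp, ?_⟩
  rw [h₂, H.edge_zero]
  rw [← h₂]
  exact hG.adj_par (by omega)

lemma exists_isCoord {a : V} (ha : 0 < P.ht a) (x : T) : ∃ b h, IsCoord P e b h x := by
  rcases H.cover x with ⟨b, rfl⟩ | ⟨b, c, hbc, t, ht, rfl⟩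
  · rcases Nat.eq_zero_or_pos (P.ht b) with h | h
    · rw [(P.ht_eq_zero b).1 h]
      exact ⟨_, _, isCoord_root H hG ha⟩
    · exact ⟨_, _, isCoord_vertex H hG h⟩
  · rcases (hG _ _).1 hbc with ⟨h, rfl⟩ | ⟨h, rfl⟩
    · exact ⟨b, _, h, 1 - t, ⟨by linarith [ht.2], by linarith [ht.1]⟩, rfl,
        H.edge_symm _ _ hbc.symm t ht⟩
    · exact ⟨c, _, h, t, ht, rfl, rfl⟩

lemma dist_root_coord {a : V} {h : ℝ} {x : T} (hx : IsCoord P e a h x) :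
    dist (ι P.root) x = h := by
  rw [dist_coord H hG (isCoord_root H hG hx.1) hx,
    min_eq_left (le_min hx.nonneg (Nat.cast_nonneg _))]
  ring

lemma exists_isCoord_below {a : V} {h k : ℝ} {x : T} (hx : IsCoord P e a h x) (hk : 0 ≤ k)
    (hkh : k ≤ h) : ∃ b y, IsCoord P e b k y ∧ dist y x = h - k := by
  -- The edge through height `k` ends at height `⌈k⌉₊`, except for `k = 0`, where an edge of height
  -- one is used.
  have hn : max 1 ⌈k⌉₊ ≤ P.ht a := max_le hx.1 (Nat.ceil_le.2 (hkh.trans hx.le_ht))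
  have h₁ := P.ht_anc hn
  have hs₁ : k ≤ (max 1 ⌈k⌉₊ : ℕ) := (Nat.le_ceil k).trans (by exact_mod_cast le_max_right 1 ⌈k⌉₊)
  have hs₀ : ((max 1 ⌈k⌉₊ : ℕ) : ℝ) ≤ k + 1 := by
    rcases le_total ⌈k⌉₊ 1 with h | h
    · rw [max_eq_left h]
      push_cast
      linarith
    · rw [max_eq_right h]
      exact (Nat.ceil_lt_add_one hk).le
  have hy : IsCoord P e (P.anc a (max 1 ⌈k⌉₊)) k (e (P.par (P.anc a (max 1 ⌈k⌉₊)))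
      (P.anc a (max 1 ⌈k⌉₊)) (k - ((max 1 ⌈k⌉₊ : ℕ) - 1))) :=
    ⟨by rw [h₁]; exact le_max_left 1 ⌈k⌉₊, _, ⟨by linarith, by linarith⟩, by rw [h₁]; ring, rfl⟩
  refine ⟨_, _, hy, ?_⟩
  rw [dist_coord H hG hy hx, P.meet_anc_left, P.meet_self, min_eq_left hn,
    min_eq_left (le_min hkh hs₁)]
  ring

end IsUnitRealization

namespace SimplicialTree

variable (T : SimplicialTree.{u})

/-- The Gromov product at the root. -/
noncomputable def gprod (x y : T.carrier) : ℝ :=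
  (dist T.root x + dist T.root y - dist x y) / 2

/-- A one-point tree has no edges and therefore no coordinates; it has to be split off. -/
lemma tree_cases : (∀ x, x = T.root) ∨ ∃ (V : Type u) (G : SimpleGraph V) (ι : V → T.carrier)
    (e : V → V → ℝ → T.carrier) (P : Ancestry V) (a : V), IsUnitRealization G ι e ∧
      P.IsGraph G ∧ ι P.root = T.root ∧ 0 < P.ht a := by
  obtain ⟨V, G, ι, e, hG, H, v, hv⟩ := T.simplicial
  obtain ⟨P, rfl, hP⟩ := hG.exists_ancestry v
  by_cases h : ∃ a, 0 < P.ht a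
  · obtain ⟨a, ha⟩ := h
    exact Or.inr ⟨V, G, ι, e, P, a, H, hP, hv, ha⟩
  · have hroot : ∀ a, a = P.root := fun a =>
      (P.ht_eq_zero a).1 (Nat.eq_zero_of_not_pos fun ha => h ⟨a, ha⟩)
    refine Or.inl fun x => ?_
    rcases H.cover x with ⟨a, rfl⟩ | ⟨a, b, hab, -⟩
    · rw [hroot a, hv]
    · exact (hab.ne ((hroot a).trans (hroot b).symm)).elim

/-- Simplicial trees are `0`-hyperbolic. -/
lemma min_gprod_le (x y z : T.carrier) : min (T.gprod x y) (T.gprod y z) ≤ T.gprod x z := by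
  rcases T.tree_cases with h | ⟨V, G, ι, e, P, a, H, hP, hv, ha⟩
  · rw [h x, h y, h z, min_self]
  · have hc := fun w => IsUnitRealization.exists_isCoord H hP ha w
    obtain ⟨b, k, hx⟩ := hc x
    obtain ⟨c, l, hy⟩ := hc y
    obtain ⟨d, m, hz⟩ := hc z
    have key : ∀ {b c : V} {k l : ℝ} {x y : T.carrier}, IsUnitRealization.IsCoord P e b k x →
        IsUnitRealization.IsCoord P e c l y → T.gprod x y = min k (min l (P.meet b c)) := by
      intro b c k l x y hx hy
      rw [gprod, ← hv, IsUnitRealization.dist_root_coord H hP hx,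
        IsUnitRealization.dist_root_coord H hP hy, IsUnitRealization.dist_coord H hP hx hy]
      ring
    rw [key hx hy, key hy hz, key hx hz]
    have hm : min (P.meet b c : ℝ) (P.meet c d) ≤ P.meet b d := by
      exact_mod_cast P.min_meet_le b c d
    refine le_min ?_ (le_min ?_ (le_trans ?_ hm))
    · exact (min_le_left _ _).trans (min_le_left _ _)
    · exact (min_le_right _ _).trans ((min_le_right _ _).trans (min_le_left _ _))
    · exact min_le_min ((min_le_right _ _).trans (min_le_right _ _))
        ((min_le_right _ _).trans (min_le_right _ _))

/-- Every point is joined to the root by a segment. -/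
lemma exists_below (x : T.carrier) {k : ℝ} (hk : 0 ≤ k) (hkx : k ≤ dist T.root x) :
    ∃ y, dist T.root y = k ∧ dist y x = dist T.root x - k := by
  rcases T.tree_cases with h | ⟨V, G, ι, e, P, a, H, hP, hv, ha⟩
  · rw [h x, dist_self] at hkx
    obtain rfl := le_antisymm hkx hk
    exact ⟨x, by rw [h x, dist_self], by rw [h x, dist_self, sub_zero]⟩
  · obtain ⟨b, l, hx⟩ := IsUnitRealization.exists_isCoord H hP ha x
    have hl := IsUnitRealization.dist_root_coord H hP hx
    rw [← hv, hl] at hkx ⊢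
    obtain ⟨c, y, hy, hd⟩ := IsUnitRealization.exists_isCoord_below H hP hx hk hkx
    exact ⟨y, IsUnitRealization.dist_root_coord H hP hy, hd⟩

end SimplicialTree

/-! ## The inverse sequence of spheres of a rooted simplicial tree -/

namespace SimplicialTree

variable {T : SimplicialTree.{u}}

lemma gprod_comm (x y : T.carrier) : T.gprod x y = T.gprod y x := by
  rw [gprod, gprod, dist_comm x y]; ring

lemma dist_eq_gprod (x y : T.carrier) :
    dist x y = dist T.root x + dist T.root y - 2 * T.gprod x y := by
  rw [gprod]; ring

lemma gprod_nonneg (x y : T.carrier) : 0 ≤ T.gprod x y := by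
  have := dist_triangle_left x y T.root
  rw [gprod]; linarith

lemma gprod_le_left (x y : T.carrier) : T.gprod x y ≤ dist T.root x := by
  have := dist_triangle T.root x y
  rw [gprod]; linarith

lemma gprod_le_right (x y : T.carrier) : T.gprod x y ≤ dist T.root y := by
  rw [gprod_comm]; exact gprod_le_left y x

lemma eq_of_le_gprod {x y : T.carrier} (hx : dist T.root x ≤ T.gprod x y)
    (hy : dist T.root y ≤ T.gprod x y) : x = y := by
  refine dist_le_zero.1 ?_
  rw [dist_eq_gprod]; linarith

lemma eq_root_of_dist_le {x : T.carrier} (h : dist T.root x ≤ 0) : x = T.root :=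
  (dist_le_zero.1 h).symm

/-- Clamping the height makes the later choice of a point total in `k`. -/
lemma exists_below_clamped (x : T.carrier) (k : ℝ) :
    ∃ y, dist T.root y = max 0 (min k (dist T.root x)) ∧
      dist y x = dist T.root x - max 0 (min k (dist T.root x)) :=
  T.exists_below x (le_max_left _ _) (max_le dist_nonneg (min_le_right _ _))

/-- The point at height `k` on the segment from the root to `x`, or `x` itself if its height is
less than `k`. -/
noncomputable def below (x : T.carrier) (k : ℝ) : T.carrier := (exists_below_clamped x k).choose

lemma dist_root_below (x : T.carrier) {k : ℝ} (hk : 0 ≤ k) :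
    dist T.root (below x k) = min k (dist T.root x) :=
  (exists_below_clamped x k).choose_spec.1.trans (max_eq_right (le_min hk dist_nonneg))

lemma gprod_below_self (x : T.carrier) {k : ℝ} (hk : 0 ≤ k) :
    T.gprod (below x k) x = min k (dist T.root x) := by
  have h : dist (below x k) x = dist T.root x - max 0 (min k (dist T.root x)) :=
    (exists_below_clamped x k).choose_spec.2
  rw [max_eq_right (le_min hk dist_nonneg)] at h
  rw [gprod, dist_root_below x hk, h]
  ring

/-- Hyperbolicity applied twice, along the chain `below x h`, `x`, `y`, `below y k`. -/
lemma min_le_gprod_below (x y : T.carrier) {h k : ℝ} (hh : 0 ≤ h) (hk : 0 ≤ k) :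
    min (min h (dist T.root x)) (min (min k (dist T.root y)) (T.gprod x y)) ≤
      T.gprod (below x h) (below y k) := by
  have h₁ := T.min_gprod_le (below x h) x y
  have h₂ := T.min_gprod_le (below x h) y (below y k)
  rw [gprod_below_self x hh] at h₁
  rw [gprod_comm y, gprod_below_self y hk] at h₂
  refine le_trans (le_min (le_trans (le_min ?_ ?_) h₁) ?_) h₂
  · exact min_le_left _ _
  · exact (min_le_right _ _).trans (min_le_right _ _)
  · exact (min_le_right _ _).trans (min_le_left _ _)

/-- The Gromov product is the height up to which the segments from the root coincide;
`le_gprod_of_below_eq` is the converse. -/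
lemma below_eq_below {x y : T.carrier} {k : ℝ} (hk : 0 ≤ k) (h : k ≤ T.gprod x y) :
    below x k = below y k := by
  have hx := h.trans (gprod_le_left x y)
  have hy := h.trans (gprod_le_right x y)
  have := min_le_gprod_below x y hk hk
  rw [min_eq_left hx, min_eq_left hy, min_eq_left h, min_self] at this
  apply eq_of_le_gprod
  · rwa [dist_root_below x hk, min_eq_left hx]
  · rwa [dist_root_below y hk, min_eq_left hy]

lemma below_of_le {x : T.carrier} {k : ℝ} (h : dist T.root x ≤ k) : below x k = x := by
  have hk : 0 ≤ k := dist_nonneg.trans h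
  apply eq_of_le_gprod
  · rw [gprod_below_self x hk, dist_root_below x hk]
  · rw [gprod_below_self x hk, min_eq_right h]

lemma below_below (x : T.carrier) {k l : ℝ} (hk : 0 ≤ k) (hkl : k ≤ l) :
    below (below x l) k = below x k := by
  rcases le_total (dist T.root x) l with h | h
  · rw [below_of_le h]
  · refine below_eq_below hk ?_
    rw [gprod_below_self x (hk.trans hkl), min_eq_left h]
    exact hkl

lemma le_gprod_of_below_eq {x y : T.carrier} {k : ℝ} (hk : 0 ≤ k) (hx : k ≤ dist T.root x)
    (hy : k ≤ dist T.root y) (h : below x k = below y k) : k ≤ T.gprod x y := by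
  have := T.min_gprod_le x (below x k) y
  rwa [gprod_comm x, gprod_below_self x hk, h, gprod_below_self y hk, min_eq_left hx,
    min_eq_left hy, min_self] at this

lemma below_gprod (x y : T.carrier) : below x (T.gprod x y) = below y (T.gprod x y) :=
  below_eq_below (gprod_nonneg x y) le_rfl

/-- Joint continuity of `below` follows from this. If the bound on the new Gromov product is one of
the new heights, the distance is at most the difference of heights; otherwise lowering the points
has not increased their distance. -/
lemma dist_below_below_le (x y : T.carrier) {h k : ℝ} (hh : 0 ≤ h) (hk : 0 ≤ k) :
    dist (below x h) (below y k) ≤ max |h - k| (dist x y) := by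
  have h₁ := min_le_gprod_below x y hh hk
  have h₂ : |min h (dist T.root x) - min k (dist T.root y)| ≤ max |h - k| (dist x y) :=
    (abs_min_sub_min_le_max _ _ _ _).trans (max_le_max le_rfl (by
      rw [dist_comm T.root, dist_comm T.root]
      exact abs_dist_sub_le x y T.root))
  have h₃ := dist_eq_gprod x y
  rw [dist_eq_gprod, dist_root_below x hh, dist_root_below y hk]
  have h₄ : min h (dist T.root x) ≤ dist T.root x := min_le_right _ _
  have h₅ : min k (dist T.root y) ≤ dist T.root y := min_le_right _ _
  generalize min h (dist T.root x) = a at *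
  generalize min k (dist T.root y) = b at *
  have h₆ := le_abs_self (a - b)
  have h₇ := neg_abs_le (a - b)
  rcases min_choice a (min b (T.gprod x y)) with e | e
  · rw [e] at h₁
    linarith
  · rw [e] at h₁
    rcases min_choice b (T.gprod x y) with e' | e'
    · rw [e'] at h₁
      linarith
    · rw [e'] at h₁
      exact le_max_of_le_right (by linarith)

lemma continuous_below {X : Type*} [TopologicalSpace X] {f : X → T.carrier} {φ : X → ℝ}
    (hf : Continuous f) (hφ : Continuous φ) (h : ∀ x, 0 ≤ φ x) :
    Continuous fun x => below (f x) (φ x) := by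
  refine continuous_iff_continuousAt.2 fun x => tendsto_iff_dist_tendsto_zero.2 ?_
  refine squeeze_zero (fun _ => dist_nonneg)
    (fun y => dist_below_below_le (f y) (f x) (h y) (h x)) ?_
  have : Continuous fun y => max |φ y - φ x| (dist (f y) (f x)) := by fun_prop
  have h₀ := this.tendsto x
  simpa using h₀

variable (T)

/-- The inverse sequence of the spheres around the root. -/
noncomputable def spheres : InvSeq.{u} where
  X n := {x : T.carrier // dist T.root x = n}
  bond n m h x := ⟨below x.1 n, by
    rw [dist_root_below _ (Nat.cast_nonneg n), x.2]
    exact min_eq_left (by exact_mod_cast h)⟩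
  system :=
    { map_self := fun _ x => Subtype.ext (below_of_le x.2.le)
      map_map := fun _ _ _ h _ x =>
        Subtype.ext (below_below x.1 (Nat.cast_nonneg _) (by exact_mod_cast h)) }

variable {T}

/-- By hyperbolicity the sphere of radius `k` is ultrametric, hence totally disconnected, so the
continuous projection of a connected set to it is a single point. -/
lemma below_constant_of_preconnected {X : Type*} [TopologicalSpace X] [PreconnectedSpace X]
    {f : X → T.carrier} (hf : Continuous f) {k : ℝ} (hk : 0 ≤ k)
    (h : ∀ x, k ≤ dist T.root (f x)) (x y : X) : below (f x) k = below (f y) k := by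
  let S := {z : T.carrier // dist T.root z = k}
  have : IsUltrametricDist S := ⟨fun a b c => by
    have h₁ := T.min_gprod_le a.1 b.1 c.1
    have e₁ := dist_eq_gprod a.1 b.1
    have e₂ := dist_eq_gprod b.1 c.1
    have e₃ := dist_eq_gprod a.1 c.1
    rw [a.2, b.2] at e₁
    rw [b.2, c.2] at e₂
    rw [a.2, c.2] at e₃
    change dist a.1 c.1 ≤ max (dist a.1 b.1) (dist b.1 c.1)
    rcases min_le_iff.1 h₁ with h | h
    · exact le_max_of_le_left (by linarith)
    · exact le_max_of_le_right (by linarith)⟩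
  let g : X → S := fun x => ⟨below (f x) k, by rw [dist_root_below _ hk, min_eq_left (h x)]⟩
  have hg : Continuous g :=
    Continuous.subtype_mk (continuous_below hf continuous_const fun _ => hk) _
  have hs : (Set.range g).Subsingleton := (isPreconnected_range hg).subsingleton
  exact congrArg Subtype.val (hs ⟨x, rfl⟩ ⟨y, rfl⟩)

/-! ### Action of proper maps and homotopies on spheres -/

namespace PMap

variable {R S T : SimplicialTree.{u}}

lemma exists_level (f : PMap S T) (n : ℕ) :
    ∃ N : ℕ, ∀ x, (N : ℝ) ≤ dist S.root x → (n : ℝ) ≤ dist T.root (f.map x) := by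
  obtain ⟨r, hr⟩ := (f.proper _ (Metric.isBounded_ball (x := T.root) (r := n))).subset_ball S.root
  refine ⟨⌈r⌉₊, fun x hx => ?_⟩
  by_contra h
  have : x ∈ Metric.ball S.root r := hr (by
    rw [Set.mem_preimage, Metric.mem_ball, dist_comm]
    exact not_le.1 h)
  rw [Metric.mem_ball, dist_comm] at this
  linarith [Nat.le_ceil r]

/-- A level of `S` above which the map `f` takes values above level `n`. -/
noncomputable def level (f : PMap S T) (n : ℕ) : ℕ := (f.exists_level n).choose

lemma le_dist_of_level_le (f : PMap S T) {n : ℕ} {x : S.carrier}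
    (h : (f.level n : ℝ) ≤ dist S.root x) : (n : ℝ) ≤ dist T.root (f.map x) :=
  (f.exists_level n).choose_spec x h

/-- The segment from `below x k` to `x` stays above `f.level n`, so its image is a connected set
above height `n` and has only one projection there. -/
lemma below_map_below (f : PMap S T) {n : ℕ} {x : S.carrier} {k : ℝ} (hk : f.level n ≤ k)
    (hx : f.level n ≤ dist S.root x) :
    below (f.map (below x k)) n = below (f.map x) n := by
  rcases le_total (dist S.root x) k with h | h
  · rw [below_of_le h]
  · have hk₀ : 0 ≤ k := (Nat.cast_nonneg _).trans hk
    have hc : ∀ t : unitInterval, k ≤ k + t.1 * (dist S.root x - k) := fun t => by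
      have := mul_nonneg t.2.1 (sub_nonneg.2 h)
      linarith
    have := below_constant_of_preconnected (X := unitInterval)
      (f := fun t => f.map (below x (k + t.1 * (dist S.root x - k))))
      (f.map.continuous.comp (continuous_below continuous_const (by fun_prop)
        fun t => hk₀.trans (hc t))) (Nat.cast_nonneg n) (fun t => f.le_dist_of_level_le (by
          rw [dist_root_below _ (hk₀.trans (hc t))]
          exact le_min (hk.trans (hc t)) hx)) 0 1
    have e : k + (dist S.root x - k) = dist S.root x := by ring
    simpa [e, below_of_le] using this

/-- The morphism of sequences of spheres induced by a metrically proper map. -/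
noncomputable def spheresMap (f : PMap S T) : InvSeq.PreHom S.spheres T.spheres where
  Φ := f.level
  f n x := ⟨below (f.map x.1) n, by
    rw [dist_root_below _ (Nat.cast_nonneg n)]
    exact min_eq_left (f.le_dist_of_level_le x.2.ge)⟩
  comm n n' h := by
    refine ⟨max (f.level n) (f.level n'), le_max_left _ _, le_max_right _ _, fun x => ?_⟩
    have h₁ : (f.level n : ℝ) ≤ dist S.root x.1 := by
      rw [x.2]; exact_mod_cast le_max_left _ _
    have h₂ : (f.level n' : ℝ) ≤ dist S.root x.1 := by
      rw [x.2]; exact_mod_cast le_max_right _ _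
    refine Subtype.ext ?_
    change below (f.map (below x.1 (f.level n))) n =
      below (below (f.map (below x.1 (f.level n'))) n') n
    rw [f.below_map_below le_rfl h₁, f.below_map_below le_rfl h₂,
      below_below _ (Nat.cast_nonneg n) (by exact_mod_cast h.le)]

lemma spheresMap_bond (f : PMap S T) {n m : ℕ} (h : f.level n ≤ m) (x : S.spheres.X m) :
    (f.spheresMap.f n (S.spheres.bond h x)).1 = below (f.map x.1) n :=
  f.below_map_below le_rfl (by rw [x.2]; exact_mod_cast h)

lemma spheresMap_rel {f g : PMap S T} (h : Homotopic f g) :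
    InvSeq.PreHom.Rel f.spheresMap g.spheresMap := by
  intro n
  obtain ⟨H, -, hH⟩ := h
  -- The radius is `n + 1` because it must be positive also for `n = 0`.
  obtain ⟨N, -, hN⟩ := hH (n + 1) (by positivity)
  refine ⟨max (max (f.level n) (g.level n)) ⌈N⌉₊, (le_max_left _ _).trans (le_max_left _ _),
    (le_max_right _ _).trans (le_max_left _ _), fun x => Subtype.ext ?_⟩
  refine (f.spheresMap_bond _ x).trans (Eq.trans ?_ (g.spheresMap_bond _ x).symm)
  have hx : N ≤ dist S.root x.1 := by
    rw [x.2]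
    exact (Nat.le_ceil N).trans (by exact_mod_cast le_max_right _ _)
  -- The track of a distant point under the homotopy never drops below height `n`.
  have := below_constant_of_preconnected (X := unitInterval) (f := fun t => H (t, x.1))
    (by fun_prop) (Nat.cast_nonneg n) (fun t => by
      by_contra h
      have := hN t x.1 (by rw [Metric.mem_ball, dist_comm]; linarith)
      rw [Metric.mem_ball, dist_comm] at this
      linarith) 0 1
  simpa using this

end PMap

/-- Rooted simplicial trees as inverse sequences. -/
noncomputable def toInvSeq : SimplicialTree.{u} ⥤ InvSeq.{u} where
  obj T := T.spheres
  map f := Quotient.map PMap.spheresMap (fun _ _ h => PMap.spheresMap_rel h) f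
  map_id T := (InvSeq.hom_mk_eq_iff _ _).2 fun n =>
    ⟨max ((PMap.id T).level n) n, le_max_left _ _, le_max_right _ _, fun x =>
      Subtype.ext ((PMap.id T).spheresMap_bond _ x)⟩
  map_comp {R S T} f g := by
    induction f using Quotient.ind with | _ f
    induction g using Quotient.ind with | _ g
    refine (InvSeq.hom_mk_eq_iff _ (f.spheresMap.comp g.spheresMap)).2 fun n =>
      ⟨max ((f.comp g).level n) (f.level (g.level n)), le_max_left _ _, le_max_right _ _,
        fun x => Subtype.ext (((f.comp g).spheresMap_bond _ x).trans ?_)⟩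
    have h : (f.level (g.level n) : ℝ) ≤ dist R.root x.1 := by
      rw [x.2]; exact_mod_cast le_max_right _ _
    have e := f.spheresMap_bond (le_max_right ((f.comp g).level n) (f.level (g.level n))) x
    refine Eq.trans ?_ (congrArg (fun z => below (g.map z) n) e.symm)
    exact (g.below_map_below le_rfl (f.le_dist_of_level_le h)).symm

end SimplicialTree

/-! ## Trees embed fully faithfully into inverse sequences -/

namespace SimplicialTree

namespace PMap

variable {S T : SimplicialTree.{u}}

/-- A rooted continuous map whose values tend to infinity is metrically proper. -/
def ofLevels (f : C(S.carrier, T.carrier)) (h₀ : f S.root = T.root)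
    (h : ∀ n : ℕ, ∃ N : ℝ, ∀ x, N ≤ dist S.root x → (n : ℝ) ≤ dist T.root (f x)) : PMap S T where
  map := f
  map_root := h₀
  proper A hA := by
    obtain ⟨r, hr⟩ := hA.subset_ball T.root
    obtain ⟨N, hN⟩ := h ⌈r⌉₊
    refine Metric.isBounded_ball (x := S.root) (r := N) |>.subset fun x hx => ?_
    by_contra hx'
    rw [Metric.mem_ball, dist_comm, not_lt] at hx'
    have := hr hx
    rw [Metric.mem_ball, dist_comm] at this
    linarith [hN x hx', Nat.le_ceil r]

lemma homotopic_of_levels {f g : PMap S T} (H : ContinuousMap.Homotopy f.map g.map)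
    (h₀ : ∀ t, H (t, S.root) = T.root)
    (h : ∀ n : ℕ, ∃ N : ℝ, ∀ t x, N ≤ dist S.root x → (n : ℝ) ≤ dist T.root (H (t, x))) :
    Homotopic f g := by
  refine ⟨H, h₀, fun M _ => ?_⟩
  obtain ⟨N, hN⟩ := h ⌈M⌉₊
  refine ⟨max N 1, by positivity, fun t x hx => ?_⟩
  rw [Metric.mem_ball, dist_comm] at hx ⊢
  by_contra hx'
  linarith [hN t x ((le_max_left _ _).trans (not_lt.1 hx')), Nat.le_ceil M]

lemma continuous_gprod : Continuous fun p : T.carrier × T.carrier => T.gprod p.1 p.2 := by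
  unfold gprod
  fun_prop

lemma gprod_root_left (x : T.carrier) : T.gprod T.root x = 0 := by
  rw [gprod, dist_self]; ring

/-- The branching point of the images under two maps that are close at infinity. -/
noncomputable def branch (f g : PMap S T)
    (h : ∀ n : ℕ, ∃ N : ℝ, ∀ x, N ≤ dist S.root x → (n : ℝ) ≤ T.gprod (f.map x) (g.map x)) :
    PMap S T :=
  ofLevels ⟨fun x => below (f.map x) (T.gprod (f.map x) (g.map x)),
      continuous_below f.map.continuous (continuous_gprod.comp (by fun_prop :
        Continuous fun x => (f.map x, g.map x))) fun _ => gprod_nonneg _ _⟩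
    (by
      refine eq_root_of_dist_le ?_
      change dist T.root (below _ _) ≤ 0
      rw [dist_root_below _ (gprod_nonneg _ _), f.map_root]
      exact (min_le_left _ _).trans (gprod_root_left _).le)
    (fun n => by
      obtain ⟨N, hN⟩ := h n
      refine ⟨N, fun x hx => ?_⟩
      change _ ≤ dist T.root (below _ _)
      rw [dist_root_below _ (gprod_nonneg _ _)]
      exact le_min (hN x hx) ((hN x hx).trans (gprod_le_left _ _)))

/-- Each `f.map x` slides towards the root until it reaches the branching point. Heights never fall
below the Gromov product, so the homotopy is proper. -/
lemma homotopic_branch (f g : PMap S T)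
    (h : ∀ n : ℕ, ∃ N : ℝ, ∀ x, N ≤ dist S.root x → (n : ℝ) ≤ T.gprod (f.map x) (g.map x)) :
    Homotopic f (branch f g h) := by
  let φ : unitInterval × S.carrier → ℝ := fun p =>
    (1 - p.1.1) * dist T.root (f.map p.2) + p.1.1 * T.gprod (f.map p.2) (g.map p.2)
  have hφ : ∀ p, T.gprod (f.map p.2) (g.map p.2) ≤ φ p := fun p => by
    have h₁ := gprod_le_left (f.map p.2) (g.map p.2)
    have h₂ := mul_le_mul_of_nonneg_left h₁ (sub_nonneg.2 p.1.2.2)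
    change _ ≤ (1 - p.1.1) * dist T.root (f.map p.2) + p.1.1 * T.gprod (f.map p.2) (g.map p.2)
    linarith
  have hφ₀ : ∀ p, 0 ≤ φ p := fun p => (gprod_nonneg _ _).trans (hφ p)
  have hc : Continuous φ := by
    have := (continuous_gprod (T := T)).comp (by fun_prop :
      Continuous fun p : unitInterval × S.carrier => (f.map p.2, g.map p.2))
    simp only [Function.comp_def] at this
    fun_prop
  refine homotopic_of_levels
    { toFun := fun p => below (f.map p.2) (φ p)
      continuous_toFun := continuous_below (by fun_prop) hc hφ₀
      map_zero_left := fun x => below_of_le (by simp [φ])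
      map_one_left := fun x => by
        change below (f.map x) _ = below (f.map x) _
        congr 1
        simp [φ] } ?_ ?_
  · intro t
    refine eq_root_of_dist_le ?_
    change dist T.root (below _ _) ≤ 0
    rw [dist_root_below _ (hφ₀ _), f.map_root]
    exact (min_le_right _ _).trans (dist_self _).le
  · intro n
    obtain ⟨N, hN⟩ := h n
    refine ⟨N, fun t x hx => ?_⟩
    change _ ≤ dist T.root (below _ _)
    rw [dist_root_below _ (hφ₀ _)]
    exact le_min ((hN x hx).trans (hφ (t, x))) ((hN x hx).trans (gprod_le_left _ _))

/-- Maps which are close at infinity are homotopic. -/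
lemma homotopic_of_gprod {f g : PMap S T}
    (h : ∀ n : ℕ, ∃ N : ℝ, ∀ x, N ≤ dist S.root x → (n : ℝ) ≤ T.gprod (f.map x) (g.map x)) :
    Homotopic f g := by
  have h' : ∀ n : ℕ, ∃ N : ℝ, ∀ x, N ≤ dist S.root x → (n : ℝ) ≤ T.gprod (g.map x) (f.map x) := by
    simpa only [gprod_comm] using h
  -- The branching point is symmetric in the two maps, so both homotopies end at the same map.
  have e : branch f g h = branch g f h' := by
    have : (branch f g h).map = (branch g f h').map := by
      ext x
      change below _ _ = below _ _
      rw [below_gprod, gprod_comm]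
    generalize branch f g h = a at *
    generalize branch g f h' = b at *
    cases a
    cases b
    cases this
    rfl
  exact homotopic_equivalence.trans (homotopic_branch f g h)
    (e ▸ homotopic_equivalence.symm (homotopic_branch g f h'))

/-- Agreement on the sphere of radius `m` spreads to every higher point, because projecting such a
point to this sphere first does not affect the level-`n` projection of its image. -/
lemma homotopic_of_spheresMap_rel {f g : PMap S T}
    (h : InvSeq.PreHom.Rel f.spheresMap g.spheresMap) : Homotopic f g := by
  refine homotopic_of_gprod fun n => ?_
  obtain ⟨m, h₁, h₂, e⟩ := h n
  refine ⟨m, fun x hx => ?_⟩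
  have h₁' : (f.level n : ℝ) ≤ m := by exact_mod_cast h₁
  have h₂' : (g.level n : ℝ) ≤ m := by exact_mod_cast h₂
  refine le_gprod_of_below_eq (Nat.cast_nonneg n) (f.le_dist_of_level_le (h₁'.trans hx))
    (g.le_dist_of_level_le (h₂'.trans hx)) ?_
  let y : S.spheres.X m := ⟨below x m, by
    rw [dist_root_below _ (Nat.cast_nonneg m), min_eq_left hx]⟩
  rw [← f.below_map_below h₁' (h₁'.trans hx), ← g.below_map_below h₂' (h₂'.trans hx)]
  exact (f.spheresMap_bond h₁ y).symm.trans
    ((congrArg Subtype.val (e y)).trans (g.spheresMap_bond h₂ y))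

end PMap

instance : toInvSeq.{u}.Faithful where
  map_injective {S T f g} h := by
    induction f using Quotient.ind with | _ f
    induction g using Quotient.ind with | _ g
    exact Quotient.sound (PMap.homotopic_of_spheresMap_rel ((InvSeq.hom_mk_eq_iff _ _).1 h))

/-- The largest `1`-Lipschitz function of the height which is at most `n` up to `Φ (n + 1)`. -/
noncomputable def ramp (Φ : ℕ → ℕ) (h : ℝ) : ℝ := ⨅ n : ℕ, max (n : ℝ) (n + h - Φ (n + 1))

section ramp

variable {Φ : ℕ → ℕ}

lemma ramp_bddBelow (h : ℝ) :
    BddBelow (Set.range fun n : ℕ => max (n : ℝ) (n + h - Φ (n + 1))) :=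
  ⟨0, by rintro _ ⟨n, rfl⟩; exact le_max_of_le_left (Nat.cast_nonneg n)⟩

lemma ramp_nonneg (h : ℝ) : 0 ≤ ramp Φ h :=
  le_ciInf fun n => le_max_of_le_left (Nat.cast_nonneg n)

lemma ramp_le {h : ℝ} {n : ℕ} (hn : h ≤ Φ (n + 1)) : ramp Φ h ≤ n :=
  (ciInf_le (ramp_bddBelow h) n).trans (max_le le_rfl (by linarith))

lemma ramp_mono {h k : ℝ} (hk : h ≤ k) : ramp Φ h ≤ ramp Φ k :=
  ciInf_mono (ramp_bddBelow h) fun n => max_le_max le_rfl (by linarith)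

lemma ramp_sub_le {h k : ℝ} (hk : h ≤ k) : ramp Φ k ≤ ramp Φ h + (k - h) := by
  rw [← sub_le_iff_le_add]
  refine le_ciInf fun n => ?_
  rw [sub_le_iff_le_add]
  refine (ciInf_le (ramp_bddBelow k) n).trans (max_le ?_ ?_)
  · linarith [le_max_left (n : ℝ) (n + h - Φ (n + 1))]
  · linarith [le_max_right (n : ℝ) (n + h - Φ (n + 1))]

/-- In the infimum, terms with index at least `n` are at least `n` anyway, and the others have risen
by at least `n` since passing `Φ n`. -/
lemma le_ramp (hΦ : Monotone Φ) {n : ℕ} {h : ℝ} (hn : (Φ n : ℝ) + n ≤ h) : n ≤ ramp Φ h := by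
  refine le_ciInf fun m => ?_
  rcases lt_or_ge m n with hm | hm
  · refine le_max_of_le_right ?_
    have h₁ : (Φ (m + 1) : ℝ) ≤ Φ n := by exact_mod_cast hΦ hm
    have h₂ : (0 : ℝ) ≤ m := Nat.cast_nonneg m
    linarith
  · exact le_max_of_le_left (by exact_mod_cast hm)

end ramp

/-- A sequence of maps `G n`, defined from level `Φ n` on and strictly compatible with the
projections, is realized by a metrically proper map. -/
lemma exists_pmap {S T : SimplicialTree.{u}} (Φ : ℕ → ℕ) (hΦ : StrictMono Φ) (h₀ : Φ 0 = 0)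
    (G : ℕ → S.carrier → T.carrier)
    (hG : ∀ n x, (Φ n : ℝ) ≤ dist S.root x → dist T.root (G n x) = n)
    (hbelow : ∀ n x k, (Φ n : ℝ) ≤ k → (Φ n : ℝ) ≤ dist S.root x → G n (below x k) = G n x)
    (hsucc : ∀ n x, (Φ (n + 1) : ℝ) ≤ dist S.root x → below (G (n + 1) x) n = G n x) :
    ∃ f : PMap S T, ∀ n x, (Φ n : ℝ) + n ≤ dist S.root x → below (f.map x) n = G n x := by
  have hle : ∀ n l x, n ≤ l → (Φ l : ℝ) ≤ dist S.root x → below (G l x) n = G n x := by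
    intro n l x h
    induction l, h using Nat.le_induction with
    | base => exact fun hx => below_of_le (hG n x hx).le
    | succ l h ih =>
      intro hx
      have h' : (Φ l : ℝ) ≤ dist S.root x :=
        le_trans (by exact_mod_cast hΦ.monotone l.le_succ) hx
      rw [← ih h', ← hsucc l x hx, below_below _ (Nat.cast_nonneg n) (by exact_mod_cast h)]
  -- The last level already available at height `h`; searching up to `⌊h⌋₊` suffices, as `n ≤ Φ n`.
  let ν : ℝ → ℕ := fun h => Nat.findGreatest (fun n => Φ n ≤ ⌊h⌋₊) ⌊h⌋₊
  have ν_le : ∀ {h : ℝ}, 0 ≤ h → (Φ (ν h) : ℝ) ≤ h := fun {h} hh => by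
    have : Φ (ν h) ≤ ⌊h⌋₊ := Nat.findGreatest_spec (P := fun n => Φ n ≤ ⌊h⌋₊) (Nat.zero_le _)
      (by rw [h₀]; exact Nat.zero_le _)
    exact (Nat.le_floor_iff hh).1 this
  have le_ν : ∀ {h : ℝ} {n : ℕ}, (Φ n : ℝ) ≤ h → n ≤ ν h := fun {h n} hn => by
    have := Nat.le_floor hn
    exact Nat.le_findGreatest (hΦ.le_apply.trans this) this
  have lt_ν : ∀ h : ℝ, h ≤ Φ (ν h + 1) := fun h => by
    by_contra hh
    exact absurd (le_ν (not_le.1 hh).le) (by omega)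
  have hν : ∀ h : ℝ, ramp Φ h ≤ ν h := fun h => ramp_le (lt_ν h)
  -- The newest available value is cut off at the ramp. As the ramp never exceeds `ν`, a jump of `ν`
  -- cannot be seen in `F`.
  let F : S.carrier → T.carrier := fun x =>
    below (G (ν (dist S.root x)) x) (ramp Φ (dist S.root x))
  have hF : ∀ x, dist T.root (F x) = ramp Φ (dist S.root x) := fun x => by
    rw [dist_root_below _ (ramp_nonneg _), hG _ _ (ν_le dist_nonneg), min_eq_left (hν _)]
  have F_below : ∀ x k, 0 ≤ k → k ≤ dist S.root x → F (below x k) = below (F x) (ramp Φ k) := by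
    intro x k hk hkx
    have hx : (Φ (ν k) : ℝ) ≤ dist S.root x := (ν_le hk).trans hkx
    change below (G (ν (dist S.root (below x k))) (below x k))
      (ramp Φ (dist S.root (below x k))) = below (below _ _) _
    rw [dist_root_below x hk, min_eq_left hkx, hbelow _ _ _ (ν_le hk) hx,
      ← hle _ _ x (le_ν hx) (ν_le dist_nonneg), below_below _ (ramp_nonneg _) (hν k),
      below_below _ (ramp_nonneg _) (ramp_mono hkx)]
  -- `F` commutes with projection, so the images share their segments up to the ramp of `S.gprod x
  -- y`; beyond that the ramp is `1`-Lipschitz.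
  have F_lip : LipschitzWith 1 F := LipschitzWith.mk_one fun x y => by
    have hx := gprod_le_left x y
    have hy := gprod_le_right x y
    have h₁ : ramp Φ (S.gprod x y) ≤ T.gprod (F x) (F y) := by
      refine le_gprod_of_below_eq (ramp_nonneg _) ?_ ?_ ?_
      · rw [hF]; exact ramp_mono hx
      · rw [hF]; exact ramp_mono hy
      · rw [← F_below _ _ (gprod_nonneg x y) hx, ← F_below _ _ (gprod_nonneg x y) hy, below_gprod]
    rw [dist_eq_gprod, dist_eq_gprod x, hF, hF]
    linarith [ramp_sub_le (Φ := Φ) hx, ramp_sub_le (Φ := Φ) hy]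
  refine ⟨PMap.ofLevels ⟨F, F_lip.continuous⟩ ?_ ?_, ?_⟩
  · refine eq_root_of_dist_le ?_
    change dist T.root (F _) ≤ 0
    rw [hF, dist_self]
    exact (ramp_le (n := 0) (Nat.cast_nonneg _)).trans Nat.cast_zero.le
  · refine fun n => ⟨Φ n + n, fun x hx => ?_⟩
    change _ ≤ dist T.root (F x)
    rw [hF]
    exact le_ramp hΦ.monotone hx
  · intro n x hx
    change below (below _ _) _ = _
    rw [below_below _ (Nat.cast_nonneg n) (le_ramp hΦ.monotone hx)]
    refine hle _ _ x (le_ν ?_) (ν_le dist_nonneg)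
    linarith [(Nat.cast_nonneg n : (0 : ℝ) ≤ n)]

instance : toInvSeq.{u}.Full where
  map_surjective {S T} F := by
    classical
    induction F using Quotient.ind with | _ F
    change InvSeq.PreHom S.spheres T.spheres at F
    choose m hm hm' e using fun n => F.comm (Nat.lt_succ_self n)
    -- Partial sums give `Φ 0 = 0`, strict growth, and `m n ≤ Φ (n + 1)`, the level from which
    -- components `n` and `n + 1` are strictly compatible.
    let Φ : ℕ → ℕ := fun n => ∑ i ∈ Finset.range n, (m i + 1)
    have hΦ_succ : ∀ n, Φ (n + 1) = Φ n + (m n + 1) := fun n => Finset.sum_range_succ _ _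
    have hΦ : StrictMono Φ := strictMono_nat_of_lt_succ fun n => by rw [hΦ_succ]; omega
    let pt : ∀ (n : ℕ) (x : S.carrier), (n : ℝ) ≤ dist S.root x → S.spheres.X n := fun n x h =>
      ⟨below x n, by rw [dist_root_below _ (Nat.cast_nonneg n), min_eq_left h]⟩
    -- The default value matters only for `n = 0`, where `F.Φ 0` may exceed `Φ 0 = 0`; there the
    -- root is the only possible value.
    let G : ℕ → S.carrier → T.carrier := fun n x =>
      if h : (F.Φ n : ℝ) ≤ dist S.root x then (F.f n (pt _ x h)).1 else T.root
    have G_of_le : ∀ {n x} (h : (F.Φ n : ℝ) ≤ dist S.root x), G n x = (F.f n (pt _ x h)).1 :=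
      fun h => dif_pos h
    have le_Φ : ∀ n, F.Φ (n + 1) ≤ Φ (n + 1) := fun n => by
      rw [hΦ_succ]
      have : F.Φ (n + 1) ≤ m n := hm' n
      omega
    have G_zero : ∀ x, G 0 x = T.root := fun x => by
      by_cases h : (F.Φ 0 : ℝ) ≤ dist S.root x
      · rw [G_of_le h]
        exact eq_root_of_dist_le ((F.f 0 _).2.trans Nat.cast_zero).le
      · exact dif_neg h
    have hG : ∀ n x, (Φ n : ℝ) ≤ dist S.root x → dist T.root (G n x) = n := by
      intro n x h
      rcases n with _ | n
      · rw [G_zero, dist_self, Nat.cast_zero]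
      · rw [G_of_le (le_trans (by exact_mod_cast le_Φ n) h)]
        exact (F.f _ _).2
    have hbelow : ∀ n x k, (Φ n : ℝ) ≤ k → (Φ n : ℝ) ≤ dist S.root x →
        G n (below x k) = G n x := by
      intro n x k hk hx
      rcases n with _ | n
      · rw [G_zero, G_zero]
      · have h' : (F.Φ (n + 1) : ℝ) ≤ Φ (n + 1) := by exact_mod_cast le_Φ n
        have hb : (F.Φ (n + 1) : ℝ) ≤ dist S.root (below x k) := by
          rw [dist_root_below _ ((Nat.cast_nonneg _).trans hk)]
          exact le_min (h'.trans hk) (h'.trans hx)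
        rw [G_of_le hb, G_of_le (h'.trans hx)]
        congr 2
        exact Subtype.ext (below_below x (Nat.cast_nonneg _) (h'.trans hk))
    have hsucc : ∀ n x, (Φ (n + 1) : ℝ) ≤ dist S.root x → below (G (n + 1) x) n = G n x := by
      intro n x hx
      have hmx : (m n : ℝ) ≤ dist S.root x := by
        refine le_trans ?_ hx
        have : m n ≤ Φ (n + 1) := by rw [hΦ_succ]; omega
        exact_mod_cast this
      have h₁ : (F.Φ n : ℝ) ≤ m n := by exact_mod_cast hm n
      have h₂ : (F.Φ (n + 1) : ℝ) ≤ m n := by exact_mod_cast hm' n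
      rw [G_of_le (h₁.trans hmx), G_of_le (h₂.trans hmx)]
      have key := congrArg Subtype.val (e n (pt _ x hmx))
      have b₁ : S.spheres.bond (hm n) (pt _ x hmx) = pt _ x (h₁.trans hmx) :=
        Subtype.ext (below_below x (Nat.cast_nonneg _) h₁)
      have b₂ : S.spheres.bond (hm' n) (pt _ x hmx) = pt _ x (h₂.trans hmx) :=
        Subtype.ext (below_below x (Nat.cast_nonneg _) h₂)
      rw [b₁, b₂] at key
      exact key.symm
    obtain ⟨f, hf⟩ := exists_pmap (S := S) (T := T) Φ hΦ rfl G hG hbelow hsucc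
    refine ⟨Quotient.mk _ f, (InvSeq.hom_mk_eq_iff _ _).2 fun n => ?_⟩
    refine ⟨max (max (f.level n) (F.Φ n)) (Φ n + n), (le_max_left _ _).trans (le_max_left _ _),
      (le_max_right _ _).trans (le_max_left _ _), fun x => Subtype.ext ?_⟩
    refine (f.spheresMap_bond ((le_max_left _ _).trans (le_max_left _ _)) x).trans ?_
    have h₁ : (Φ n : ℝ) + n ≤ dist S.root x.1 := by
      rw [x.2]; exact_mod_cast le_max_right _ _
    have h₂ : (F.Φ n : ℝ) ≤ dist S.root x.1 := by
      rw [x.2]; exact_mod_cast (le_max_right _ _).trans (le_max_left _ _)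
    rw [hf n _ h₁, G_of_le h₂]
    rfl

end SimplicialTree

/-! ## The rooted simplicial tree of an inverse sequence -/

namespace Ancestry

variable {V : Type u} (P : Ancestry V)

/-- Pairs `(a, h)`, representing the points at height `h` below the vertices `a`. -/
structure Pt (P : Ancestry V) : Type u where
  vertex : V
  coord : ℝ

variable {P}

/-- The height of the point represented by a pair. -/
noncomputable def Pt.height (p : P.Pt) : ℝ := max 0 (min p.coord (P.ht p.vertex))

lemma Pt.height_nonneg (p : P.Pt) : 0 ≤ p.height := le_max_left _ _

lemma Pt.height_le (p : P.Pt) : p.height ≤ P.ht p.vertex :=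
  max_le (Nat.cast_nonneg _) (min_le_right _ _)

lemma Pt.height_mk {a : V} {h : ℝ} (h₀ : 0 ≤ h) (h₁ : h ≤ P.ht a) :
    (⟨a, h⟩ : P.Pt).height = h := by
  rw [Pt.height, min_eq_left h₁, max_eq_right h₀]

/-- The height at which the segments from the root to two points separate. -/
noncomputable def Pt.gprod (p q : P.Pt) : ℝ :=
  min p.height (min q.height (P.meet p.vertex q.vertex))

/-- The triangle inequality is hyperbolicity of the separation heights. Pairs naming the same point
from different vertices above it have distance zero. -/
noncomputable instance : PseudoMetricSpace P.Pt where
  dist p q := p.height + q.height - 2 * p.gprod q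
  dist_self p := by
    rw [Pt.gprod, P.meet_self, min_eq_left p.height_le, min_self]
    ring
  dist_comm p q := by
    rw [Pt.gprod, Pt.gprod, P.meet_comm, min_left_comm]
    ring
  dist_triangle p q r := by
    have hm : min (P.meet p.vertex q.vertex : ℝ) (P.meet q.vertex r.vertex) ≤
        P.meet p.vertex r.vertex := by exact_mod_cast P.min_meet_le _ _ _
    have h₁ : p.gprod q ≤ q.height := (min_le_right _ _).trans (min_le_left _ _)
    have h₂ : q.gprod r ≤ q.height := min_le_left _ _
    have h₃ : min (p.gprod q) (q.gprod r) ≤ p.gprod r := by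
      refine le_min ?_ (le_min ?_ (le_trans ?_ hm))
      · exact (min_le_left _ _).trans (min_le_left _ _)
      · exact (min_le_right _ _).trans ((min_le_right _ _).trans (min_le_left _ _))
      · exact min_le_min ((min_le_right _ _).trans (min_le_right _ _))
          ((min_le_right _ _).trans (min_le_right _ _))
    rcases min_le_iff.1 h₃ with h | h <;> linarith

lemma Pt.dist_def (p q : P.Pt) : dist p q = p.height + q.height - 2 * p.gprod q := rfl

variable (P)

/-- The geometric realization of the tree with the vertices `V`. -/
abbrev Realization : Type u := SeparationQuotient P.Pt

/-- The point at height `h` below the vertex `a`. -/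
noncomputable def point (a : V) (h : ℝ) : P.Realization := SeparationQuotient.mk ⟨a, h⟩

/-- The point of the realization given by a vertex. -/
noncomputable def vertexPoint (a : V) : P.Realization := P.point a (P.ht a)

open Classical in
/-- The edge from `a` to `b`. -/
noncomputable def edge (a b : V) (t : ℝ) : P.Realization :=
  if 0 < P.ht b ∧ P.par b = a then P.point b (P.ht b - 1 + t) else P.point a (P.ht a - t)

variable {P}

lemma dist_point {a b : V} {h k : ℝ} (h₀ : 0 ≤ h) (h₁ : h ≤ P.ht a) (k₀ : 0 ≤ k)
    (k₁ : k ≤ P.ht b) :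
    dist (P.point a h) (P.point b k) = h + k - 2 * min h (min k (P.meet a b)) := by
  rw [point, point, SeparationQuotient.dist_mk, Pt.dist_def, Pt.gprod, Pt.height_mk h₀ h₁,
    Pt.height_mk k₀ k₁]

lemma point_eq_point {a b : V} {h : ℝ} (h₀ : 0 ≤ h) (h₁ : h ≤ P.meet a b) :
    P.point a h = P.point b h := by
  have ha := h₁.trans (by exact_mod_cast P.meet_le_left a b : (P.meet a b : ℝ) ≤ P.ht a)
  have hb := h₁.trans (by exact_mod_cast P.meet_le_right a b : (P.meet a b : ℝ) ≤ P.ht b)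
  refine dist_le_zero.1 ?_
  rw [dist_point h₀ ha h₀ hb, min_eq_left h₁, min_self]
  linarith

lemma exists_point (x : P.Realization) :
    ∃ (a : V) (h : ℝ), 0 ≤ h ∧ h ≤ P.ht a ∧ x = P.point a h := by
  obtain ⟨p, rfl⟩ := SeparationQuotient.surjective_mk x
  refine ⟨p.vertex, p.height, p.height_nonneg, p.height_le, ?_⟩
  refine dist_le_zero.1 ?_
  rw [point, SeparationQuotient.dist_mk, Pt.dist_def, Pt.gprod,
    Pt.height_mk p.height_nonneg p.height_le, P.meet_self, min_eq_left p.height_le, min_self]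
  linarith

lemma point_eq_point_anc {a : V} {h : ℝ} (h₀ : 0 ≤ h) (h₁ : h ≤ P.ht a) :
    P.point a h = P.point (P.anc a ⌈h⌉₊) h := by
  refine point_eq_point h₀ ?_
  rw [P.meet_comm, P.meet_anc_left, P.meet_self, min_eq_left (Nat.ceil_le.2 h₁)]
  exact Nat.le_ceil h

lemma edge_par {b : V} (hb : 0 < P.ht b) (t : ℝ) :
    P.edge (P.par b) b t = P.point b (P.ht b - 1 + t) :=
  if_pos ⟨hb, rfl⟩

lemma edge_par' {b : V} (hb : 0 < P.ht b) (t : ℝ) :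
    P.edge b (P.par b) t = P.point b (P.ht b - 1 + (1 - t)) := by
  rw [edge, if_neg]
  · congr 1
    ring
  · rintro ⟨h₁, h₂⟩
    have e₁ := P.ht_par b
    have e₂ := P.ht_par (P.par b)
    rw [h₂] at e₂
    omega

lemma coord_mem {b : V} (hb : 0 < P.ht b) {t : ℝ} (ht : t ∈ Set.Icc (0 : ℝ) 1) :
    0 ≤ P.ht b - 1 + t ∧ P.ht b - 1 + t ≤ P.ht b := by
  have : (1 : ℝ) ≤ P.ht b := by exact_mod_cast hb
  constructor <;> linarith [ht.1, ht.2]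

lemma one_sub_mem {t : ℝ} (ht : t ∈ Set.Icc (0 : ℝ) 1) : 1 - t ∈ Set.Icc (0 : ℝ) 1 :=
  ⟨by linarith [ht.2], by linarith [ht.1]⟩

lemma dist_point_same_edge {b : V} (hb : 0 < P.ht b) {s t : ℝ} (hs : s ∈ Set.Icc (0 : ℝ) 1)
    (ht : t ∈ Set.Icc (0 : ℝ) 1) :
    dist (P.point b (P.ht b - 1 + s)) (P.point b (P.ht b - 1 + t)) = |s - t| := by
  obtain ⟨s₀, s₁⟩ := coord_mem hb hs
  obtain ⟨t₀, t₁⟩ := coord_mem hb ht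
  rw [dist_point s₀ s₁ t₀ t₁, P.meet_self, min_eq_left t₁]
  rcases le_total s t with h | h
  · rw [abs_of_nonpos (by linarith), min_eq_left (by linarith)]
    ring
  · rw [abs_of_nonneg (by linarith), min_eq_right (by linarith)]
    ring

lemma dist_point_edges {a c : V} (ha : 0 < P.ht a) (hc : 0 < P.ht c) (hne : a ≠ c) {s t : ℝ}
    (hs : s ∈ Set.Icc (0 : ℝ) 1) (ht : t ∈ Set.Icc (0 : ℝ) 1) :
    dist (P.point a (P.ht a - 1 + s)) (P.point c (P.ht c - 1 + t)) =
      min (min (s + P.graph.dist (P.par a) (P.par c) + t)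
          (s + P.graph.dist (P.par a) c + (1 - t)))
        (min ((1 - s) + P.graph.dist a (P.par c) + t) ((1 - s) + P.graph.dist a c + (1 - t))) := by
  obtain ⟨s₀, s₁⟩ := coord_mem ha hs
  obtain ⟨t₀, t₁⟩ := coord_mem hc ht
  rw [dist_point s₀ s₁ t₀ t₁, P.isGraph_graph.edge_dist_eq ha hc hne hs ht]

lemma dist_vertexPoint (a b : V) :
    dist (P.vertexPoint a) (P.vertexPoint b) = P.graph.dist a b := by
  have h := P.isGraph_graph.dist_eq a b
  have h' : (P.graph.dist a b : ℝ) + 2 * P.meet a b = P.ht a + P.ht b := by exact_mod_cast h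
  have ha : (P.meet a b : ℝ) ≤ P.ht a := by exact_mod_cast P.meet_le_left a b
  have hb : (P.meet a b : ℝ) ≤ P.ht b := by exact_mod_cast P.meet_le_right a b
  rw [vertexPoint, vertexPoint, dist_point (Nat.cast_nonneg _) le_rfl (Nat.cast_nonneg _) le_rfl,
    min_eq_right hb, min_eq_right ha]
  linarith

lemma point_par {b : V} (hb : 0 < P.ht b) :
    P.point b (P.ht b - 1 + 0) = P.vertexPoint (P.par b) := by
  have h : ((P.ht (P.par b) : ℕ) : ℝ) = P.ht b - 1 + 0 := by
    rw [P.ht_par, Nat.cast_sub hb]; simp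
  rw [vertexPoint, h]
  refine point_eq_point (coord_mem hb (by simp)).1 ?_
  rw [P.meet_par_right hb, P.meet_self, min_eq_left (Nat.sub_le _ _), Nat.cast_sub hb]
  simp

variable (P) in
lemma isUnitRealization : IsUnitRealization P.graph P.vertexPoint P.edge where
  dist_vertex := dist_vertexPoint
  edge_zero := by
    rintro a b (⟨h, rfl⟩ | ⟨h, rfl⟩)
    · rw [edge_par' h, vertexPoint]
      congr 1
      ring
    · rw [edge_par h, point_par h]
  edge_symm := by
    rintro a b (⟨h, rfl⟩ | ⟨h, rfl⟩) t ht
    · rw [edge_par h, edge_par' h, sub_sub_cancel]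
    · rw [edge_par h, edge_par' h]
  dist_edge := by
    rintro a b (⟨h, rfl⟩ | ⟨h, rfl⟩) s hs t ht
    · rw [edge_par' h, edge_par' h, dist_point_same_edge h (one_sub_mem hs) (one_sub_mem ht),
        sub_sub_sub_cancel_left, abs_sub_comm]
    · rw [edge_par h, edge_par h, dist_point_same_edge h hs ht]
  dist_edges := by
    rintro a b c d (⟨h, rfl⟩ | ⟨h, rfl⟩) (⟨h', rfl⟩ | ⟨h', rfl⟩) hne s hs t ht
    · rw [edge_par' h, edge_par' h', dist_point_edges h h' (by rintro rfl; exact hne rfl)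
        (one_sub_mem hs) (one_sub_mem ht), sub_sub_cancel, sub_sub_cancel, min_comm,
        min_comm (s + _ + _), min_comm ((1 - s) + _ + _)]
    · rw [edge_par' h, edge_par h', dist_point_edges h h'
        (by rintro rfl; exact hne Sym2.eq_swap) (one_sub_mem hs) ht, sub_sub_cancel, min_comm]
    · rw [edge_par h, edge_par' h', dist_point_edges h h'
        (by rintro rfl; exact hne Sym2.eq_swap) hs (one_sub_mem ht), sub_sub_cancel,
        min_comm (s + _ + _), min_comm ((1 - s) + _ + _)]
    · rw [edge_par h, edge_par h', dist_point_edges h h' (by rintro rfl; exact hne rfl) hs ht]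
  cover x := by
    obtain ⟨a, h, h₀, h₁, rfl⟩ := exists_point x
    -- The point lies on the edge below the ancestor of height `⌈h⌉₊`, or is the root if this height
    -- is zero.
    have hb := P.ht_anc (Nat.ceil_le.2 h₁)
    rw [point_eq_point_anc h₀ h₁]
    generalize P.anc a ⌈h⌉₊ = b at *
    rcases Nat.eq_zero_or_pos (P.ht b) with hz | hpos
    · refine Or.inl ⟨b, ?_⟩
      have : h = 0 := le_antisymm (Nat.ceil_eq_zero.1 (hb.symm.trans hz)) h₀
      rw [vertexPoint, hz, this, Nat.cast_zero]
    · refine Or.inr ⟨P.par b, b, P.isGraph_graph.adj_par hpos, h - (P.ht b - 1), ⟨?_, ?_⟩, ?_⟩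
      · rw [hb]
        linarith [Nat.ceil_lt_add_one h₀]
      · rw [hb]
        linarith [Nat.le_ceil h]
      · rw [edge_par hpos]
        congr 1
        ring

variable (P)

/-- The rooted simplicial tree with the vertices `V`. -/
noncomputable def tree : SimplicialTree.{u} where
  carrier := P.Realization
  root := P.vertexPoint P.root
  simplicial := ⟨V, P.graph, P.vertexPoint, P.edge, P.isGraph_graph.isTree, P.isUnitRealization,
    P.root, rfl⟩

lemma dist_root_point {a : V} {h : ℝ} (h₀ : 0 ≤ h) (h₁ : h ≤ P.ht a) :
    dist P.tree.root (P.point a h) = h := by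
  have h₂ : P.ht P.root = 0 := (P.ht_eq_zero _).2 rfl
  change dist (P.point P.root (P.ht P.root)) (P.point a h) = h
  rw [h₂, Nat.cast_zero, dist_point le_rfl (Nat.cast_nonneg _) h₀ h₁,
    min_eq_left (le_min h₀ (Nat.cast_nonneg _))]
  ring

lemma dist_root_vertexPoint (a : V) : dist P.tree.root (P.vertexPoint a) = P.ht a :=
  P.dist_root_point (Nat.cast_nonneg _) le_rfl

lemma vertexPoint_injective : Function.Injective P.vertexPoint := fun a b h => by
  have := dist_vertexPoint (P := P) a b
  rw [h, dist_self, eq_comm, Nat.cast_eq_zero] at this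
  exact P.isGraph_graph.connected.dist_eq_zero_iff.1 this

lemma exists_vertexPoint {x : P.tree.carrier} {n : ℕ} (hx : dist P.tree.root x = n) :
    ∃ a, P.ht a = n ∧ x = P.vertexPoint a := by
  obtain ⟨a, h, h₀, h₁, rfl⟩ := exists_point x
  rw [P.dist_root_point h₀ h₁] at hx
  subst hx
  have hb := P.ht_anc (by exact_mod_cast h₁ : n ≤ P.ht a)
  refine ⟨P.anc a n, hb, ?_⟩
  rw [point_eq_point_anc h₀ h₁, Nat.ceil_natCast, vertexPoint, hb]

lemma below_vertexPoint (a : V) {n : ℕ} (hn : n ≤ P.ht a) :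
    SimplicialTree.below (T := P.tree) (P.vertexPoint a) n = P.vertexPoint (P.anc a n) := by
  have hb := P.ht_anc hn
  have hb' : dist P.tree.root (P.vertexPoint (P.anc a n)) = n := by
    rw [P.dist_root_vertexPoint, hb]
  have hd : dist (P.vertexPoint a) (P.vertexPoint (P.anc a n)) = P.ht a - n := by
    have := P.isGraph_graph.dist_eq (P.anc a n) a
    rw [P.meet_anc_left, P.meet_self, min_eq_left hn, hb] at this
    rw [dist_comm, dist_vertexPoint, eq_sub_iff_add_eq]
    norm_cast
    omega
  refine (SimplicialTree.below_eq_below (Nat.cast_nonneg n) ?_).trans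
    (SimplicialTree.below_of_le hb'.le)
  have hg : P.tree.gprod (P.vertexPoint a) (P.vertexPoint (P.anc a n)) =
    (P.ht a + n - (P.ht a - n)) / 2 := by
    rw [← hd, ← hb', ← P.dist_root_vertexPoint a]
    rfl
  rw [hg]
  linarith

end Ancestry

/-! ### Recovering a sequence from the spheres of its tree -/

namespace InvSeq

variable (A : InvSeq.{u})

/-- The elements of an inverse sequence together with a root. -/
def ancestry : Ancestry (Option (Σ n, A.X n)) where
  ht
    | none => 0
    -- Height zero is reserved for the added root, since `A.X 0` need not be a single point; level
    -- `n` becomes the sphere of radius `n + 1`.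
    | some ⟨n, _⟩ => n + 1
  par
    | none => none
    | some ⟨0, _⟩ => none
    | some ⟨n + 1, x⟩ => some ⟨n, A.bond n.le_succ x⟩
  root := none
  ht_par := by rintro (_ | ⟨_ | n, x⟩) <;> rfl
  ht_eq_zero := by
    rintro (_ | ⟨n, x⟩)
    · exact ⟨fun _ => rfl, fun _ => rfl⟩
    · exact ⟨fun h => absurd h (Nat.succ_ne_zero n), fun h => nomatch h⟩

lemma ancestry_anc {n m : ℕ} (h : n ≤ m) (x : A.X m) :
    A.ancestry.anc (some ⟨m, x⟩) (n + 1) = some ⟨n, A.bond h x⟩ := by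
  induction m, h using Nat.le_induction with
  | base =>
    rw [A.bond_self]
    exact A.ancestry.anc_of_le le_rfl
  | succ m h ih =>
    rw [← A.ancestry.anc_par (Nat.succ_lt_succ (Nat.lt_succ_of_le h))]
    exact (ih (A.bond m.le_succ x)).trans (by rw [bond_bond])

/-- Sequences that agree up to a shift are isomorphic. -/
lemma nonempty_iso_of_shift {A B : InvSeq.{u}} (j : ∀ n, A.X n → B.X (n + 1))
    (hj : ∀ n, Function.Bijective (j n))
    (hnat : ∀ ⦃n m : ℕ⦄ (h : n ≤ m) (x : A.X m),
      B.bond (Nat.succ_le_succ h) (j m x) = j n (A.bond h x)) : Nonempty (B ≅ A) := by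
  choose i hi using fun n => (hj n).2
  have hi' : ∀ n x, i n (j n x) = x := fun n x => (hj n).1 (hi n _)
  let F : PreHom B A :=
    { Φ := fun n => n + 1
      f := i
      comm := fun n m h => ⟨m + 1, Nat.succ_le_succ h.le, le_rfl, fun x => by
        rw [bond_self]
        refine (hj n).1 ?_
        rw [hi, ← hnat, hi]⟩ }
  let G : PreHom A B :=
    { Φ := fun n => n
      f := fun n x => B.bond n.le_succ (j n x)
      comm := fun n m h => ⟨m, h.le, le_rfl, fun x => by
        rw [bond_self, ← hnat, bond_bond, bond_bond]⟩ }
  refine ⟨⟨Quotient.mk _ F, Quotient.mk _ G, ?_, ?_⟩⟩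
  · refine (hom_mk_eq_iff (F.comp G) (PreHom.id _)).2 fun n =>
      ⟨n + 1, le_rfl, n.le_succ, fun x => ?_⟩
    change B.bond _ (j n (i n (B.bond _ x))) = B.bond _ x
    rw [hi]
    exact B.bond_bond _ _ _
  · refine (hom_mk_eq_iff (G.comp F) (PreHom.id _)).2 fun n =>
      ⟨n + 1, le_rfl, n.le_succ, fun x => ?_⟩
    change i n (B.bond _ (j (n + 1) (A.bond _ x))) = A.bond _ x
    rw [hnat n.le_succ, hi']
    exact A.bond_bond _ _ _

lemma spheres_tree_iso : Nonempty (A.ancestry.tree.spheres ≅ A) := by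
  refine nonempty_iso_of_shift
    (fun n x => ⟨A.ancestry.vertexPoint (some ⟨n, x⟩), A.ancestry.dist_root_vertexPoint _⟩)
    (fun n => ⟨fun x y h => ?_, fun x => ?_⟩) (fun n m h x => Subtype.ext ?_)
  · have := A.ancestry.vertexPoint_injective (congrArg Subtype.val h)
    simpa using this
  · obtain ⟨a, ha, hx⟩ := A.ancestry.exists_vertexPoint x.2
    rcases a with _ | ⟨m, y⟩
    · exact absurd ha (Nat.succ_ne_zero n).symm
    · obtain rfl : m = n := Nat.succ_injective ha
      exact ⟨y, Subtype.ext hx.symm⟩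
  · refine (A.ancestry.below_vertexPoint _ (Nat.succ_le_succ h)).trans ?_
    rw [ancestry_anc]

/-- The Mittag-Leffler property is invariant under isomorphisms. -/
lemma IsML.of_iso {A B : InvSeq.{u}} (e : A ≅ B) (hA : A.IsML) : B.IsML := by
  obtain ⟨F, hF⟩ := Quotient.exists_rep e.hom
  obtain ⟨G, hG⟩ := Quotient.exists_rep e.inv
  -- Only this composite is used: the property passes to retracts. A deep element of `B` is sent by
  -- `G` to a stable element of `A`, lifted arbitrarily high there, and sent back by `F`.
  have hGF : PreHom.Rel (G.comp F) (PreHom.id B) := by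
    refine (hom_mk_eq_iff _ _).1 ?_
    change (Quotient.mk _ G : B ⟶ A) ≫ (Quotient.mk _ F : A ⟶ B) = 𝟙 B
    rw [hF, hG, e.inv_hom_id]
  intro n
  obtain ⟨N, hN, hr⟩ := hA (F.Φ n)
  obtain ⟨k, h₁, h₂, hk⟩ := hGF n
  obtain ⟨l, h₃, h₄, hl⟩ := G.comm_le hN.le
  refine ⟨max (max k l) n + 1, by omega, fun m hm => Set.Subset.antisymm ?_ ?_⟩
  · rintro _ ⟨y, rfl⟩
    exact ⟨B.bond hm.le y, B.bond_bond _ _ _⟩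
  · rintro _ ⟨y, rfl⟩
    obtain ⟨p, h₅, h₆, hp⟩ := F.comm_le (show n ≤ m by omega)
    have hlt : N < max (max N p) m + 1 := by omega
    have hy : A.bond hN.le (G.f N (B.bond (by omega) y)) ∈ Set.range (A.bond hN.le) := ⟨_, rfl⟩
    rw [← hr _ hlt] at hy
    obtain ⟨w, hw⟩ := hy
    refine ⟨F.f m (A.bond (by omega) w), ?_⟩
    have e₁ := hp (A.bond (by omega) w)
    have e₂ := hl (B.bond (by omega) y)
    have e₃ := hk (B.bond (by omega) y)
    simp only [bond_bond] at e₁ e₂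
    rw [← e₁, hw, ← e₂]
    refine Eq.trans ?_ (e₃.trans (B.bond_bond _ _ _))
    exact congrArg (F.f n) (congrArg (G.f (F.Φ n)) (B.bond_bond _ _ _).symm)

end InvSeq

/-! ### Mittag-Leffler trees and Mittag-Leffler sequences -/

namespace SimplicialTree

variable (T : SimplicialTree.{u})

/-- Equality in the triangle inequality says that the Gromov product of `α` and `β` is the height of
`α`, that is, `α` is the projection of `β`. -/
lemma extendable_eq {n m : ℕ} (h : n ≤ m) :
    T.extendable n m = Subtype.val '' Set.range (T.spheres.bond h) := by
  have hn : (n : ℝ) ≤ m := by exact_mod_cast h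
  ext α
  constructor
  · rintro ⟨hα, β, hβ, hd⟩
    refine ⟨_, ⟨⟨β, hβ⟩, rfl⟩, ?_⟩
    change below β n = α
    rw [← below_of_le hα.le]
    refine (below_eq_below (Nat.cast_nonneg n) ?_).symm
    rw [gprod]
    linarith
  · rintro ⟨_, ⟨β, rfl⟩, rfl⟩
    refine ⟨(T.spheres.bond h β).2, β.1, β.2, ?_⟩
    have e := gprod_below_self β.1 (Nat.cast_nonneg n)
    rw [gprod] at e
    change dist T.root (below β.1 n) + dist (below β.1 n) β.1 = _
    rw [dist_root_below β.1 (Nat.cast_nonneg n), β.2, min_eq_left hn] at *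
    linarith

lemma spheres_isML_iff : T.spheres.IsML ↔ T.IsML := by
  refine forall_congr' fun n => ?_
  have key : ∀ (k : ℕ) (h : n < k) (m : ℕ) (hm : k < m),
      Set.range (T.spheres.bond (h.trans hm).le) = Set.range (T.spheres.bond h.le) ↔
        T.extendable n m = T.extendable n k := fun k h m hm => by
    rw [T.extendable_eq (h.trans hm).le, T.extendable_eq h.le]
    exact (Set.image_injective.2 Subtype.val_injective).eq_iff.symm
  constructor
  · rintro ⟨k, h, hk⟩
    exact ⟨k, h, fun m hm => (key k h m hm).1 (hk m hm)⟩
  · rintro ⟨k, h, hk⟩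
    exact ⟨k, h, fun m hm => (key k h m hm).2 (hk m hm)⟩

/-- Mittag-Leffler trees as Mittag-Leffler sequences. -/
noncomputable def toTowerML : TreeML.{u} ⥤ TowerML.{u} :=
  ObjectProperty.lift _ (ObjectProperty.ι _ ⋙ toInvSeq) fun T =>
    T.obj.spheres_isML_iff.2 T.property

instance : toTowerML.{u}.Faithful where
  map_injective {X Y _ _} h := ObjectProperty.hom_ext _ (toInvSeq.map_injective
    (congrArg (fun k : toTowerML.obj X ⟶ toTowerML.obj Y => k.hom) h))

instance : toTowerML.{u}.Full where
  map_surjective {X Y} F := by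
    obtain ⟨f, hf⟩ := toInvSeq.map_surjective (X := X.obj) (Y := Y.obj) F.hom
    exact ⟨ObjectProperty.homMk f, ObjectProperty.hom_ext _ hf⟩

instance : toTowerML.{u}.EssSurj where
  mem_essImage A := by
    obtain ⟨i⟩ := A.obj.spheres_tree_iso
    exact ⟨⟨A.obj.ancestry.tree, (spheres_isML_iff _).1 (InvSeq.IsML.of_iso i.symm A.property)⟩,
      ⟨(ObjectProperty.fullyFaithfulι _).preimageIso i⟩⟩

instance : toTowerML.{u}.IsEquivalence where

end SimplicialTree

theorem corollary7p15 :
    -- Mittag-Leffler inverse sequences and complete ultrametric spaces of diameter at most one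
    (∃ E : TowerML.{u} ≌ UltraSpace.{u}, InducesStarEquivalence E.functor ∧
      -- shape morphisms are represented by uniformly continuous maps
      ∀ (σ : CoherentIsos TowerML.{u}) (X Y : TowerML.{u}),
        ∃ ρ : (StarCat.of σ X ⟶ StarCat.of σ Y) ≃
            {g : (E.functor.obj X).carrier → (E.functor.obj Y).carrier // UniformContinuous g},
          ∀ f : X ⟶ Y, ρ (StarCat.homOf σ f) = E.functor.map f) ∧
    -- Mittag-Leffler rooted simplicial trees and complete ultrametric spaces
    (∃ E : UltraSpace.{u} ≌ TreeML.{u}, InducesStarEquivalence E.functor) := by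
  refine ⟨⟨UltraSpace.toTowerML.asEquivalence.symm, inducesStarEquivalence_of_isEquivalence _,
    fun σ X Y => ?_⟩,
    ⟨UltraSpace.toTowerML.asEquivalence.trans SimplicialTree.toTowerML.asEquivalence.symm,
      inducesStarEquivalence_of_isEquivalence _⟩⟩
  -- Morphisms between classes are the morphisms `X ⟶ Y` themselves, so full faithfulness of the
  -- equivalence gives the bijection.
  let ε := Equiv.ofBijective (StarCat.homOf σ : (X ⟶ Y) → _)
    ⟨StarCat.homOf_injective σ, StarCat.homOf_surjective σ⟩
  refine ⟨ε.symm.trans (UltraSpace.toTowerML.asEquivalence.symm.fullyFaithfulFunctor.homEquiv),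
    fun f => ?_⟩
  have h : ε.symm (StarCat.homOf σ f) = f := ε.symm_apply_apply f
  change UltraSpace.toTowerML.asEquivalence.symm.functor.map (ε.symm (StarCat.homOf σ f)) = _
  rw [h]
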